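/- Let $n\ge 1$ and $N$ be natural numbers, and let $\alpha^1,\dots,\alpha^n,\beta$ be self-adjoint complex $N\times N$ matrices with $\alpha^j\alpha^k+\alpha^k\alpha^j=2\delta_{jk}I_N$, $\alpha^j\beta+\beta\alpha^j=0$ and $\beta^2=I_N$ for $1\le j,k\le n$. Let $\mathrm g>0$, $M\ge 0$ and $m\in\mathbb R$, write $D_0=-\mathrm i\sum_{j}\alpha^j\partial_{x_j}$ and $\bar\psi\psi=\psi^*\beta\psi$, and consider the Dirac--Klein--Gordon system $$\mathrm i\,\partial_t\psi=D_0\psi+(m-\mathrm g\varphi)\beta\psi,\qquad (\partial_t^2-\Delta+M^2)\varphi=\bar\psi\psi,$$ for $\psi(t,x)\in\mathbb C^N$, $\varphi(t,x)\in\mathbb R$, $(t,x)\in\mathbb R\times\mathbb R^n$, understood in the sense of distributions. Let $\omega\in(-m,m)$. Then this system has no solitary wave solution $$(\psi(t,x),\varphi(t,x))=(\phi(x)e^{-\mathrm i\omega t},\,h(x)),\qquad \phi\not\equiv 0,$$ with $\phi\in L^2(\mathbb R^n,\mathbb C^N)$ and $h\in L^\infty(\mathbb R^n,\mathbb R)$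 such that $\bar\phi\phi\le 0$ almost everywhere in $\mathbb R^n$; here, in the massless case $M=0$ in dimension $n\ge 3$ only, it is also required of a solitary wave that $h$ vanish at infinity, in the sense that $\{x:|h(x)|>\varepsilon\}$ has finite Lebesgue measure for every $\varepsilon>0$. -/

import Mathlib

open MeasureTheory Set

noncomputable section

/-- `α 0, …, α (n-1)` and `β` are `N × N` Dirac matrices: they are self-adjoint, and
`αʲ αᵏ + αᵏ αʲ = 2 δⱼₖ`, `αʲ β + β αʲ = 0`, `β² = 1`. -/
structure IsDiracMatrices {n N : ℕ} (α : Fin n → Matrix (Fin N) (Fin N) ℂ)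
    (β : Matrix (Fin N) (Fin N) ℂ) : Prop where
  alpha_hermitian : ∀ j, (α j).IsHermitian
  beta_hermitian : β.IsHermitian
  alpha_anticomm : ∀ j k, α j * α k + α k * α j = if j = k then 2 else 0
  alpha_beta_anticomm : ∀ j, α j * β + β * α j = 0
  beta_sq : β ^ 2 = 1

/-- The density `ψ̄ψ = ψ* β ψ` of a spinor `ψ ∈ ℂᴺ`, as a real number
(for self-adjoint `β` the complex number `ψ* β ψ` is real). -/
def diracDensity {N : ℕ} (β : Matrix (Fin N) (Fin N) ℂ) (ψ : Fin N → ℂ) : ℝ :=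
  (star ψ ⬝ᵥ β.mulVec ψ).re

/-- `(ψ, χ)` is a solution, in the sense of distributions on `ℝ × ℝⁿ`, of the
Dirac--Klein--Gordon system
`i ∂ₜψ = -i ∑ⱼ αʲ ∂ⱼψ + (m - g χ) β ψ`, `(∂ₜ² - Δ + M²) χ = ψ̄ψ`.
All fields and products that occur are locally integrable, and both equations hold when
integrated against every real test function `η ∈ C_c^∞(ℝ × ℝⁿ)`. -/
structure IsDKGSolution {n N : ℕ} (α : Fin n → Matrix (Fin N) (Fin N) ℂ)
    (β : Matrix (Fin N) (Fin N) ℂ) (m g M : ℝ)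
    (ψ : ℝ × EuclideanSpace ℝ (Fin n) → Fin N → ℂ)
    (χ : ℝ × EuclideanSpace ℝ (Fin n) → ℝ) : Prop where
  locallyIntegrable_spinor : LocallyIntegrable ψ volume
  locallyIntegrable_scalar : LocallyIntegrable χ volume
  locallyIntegrable_coupling : LocallyIntegrable (fun p => χ p • ψ p) volume
  locallyIntegrable_density : LocallyIntegrable (fun p => diracDensity β (ψ p)) volume
  dirac : ∀ η : ℝ × EuclideanSpace ℝ (Fin n) → ℝ, ContDiff ℝ (⊤ : ℕ∞) η → HasCompactSupport η →
    -Complex.I • ∫ p, deriv (fun s => η (s, p.2)) p.1 • ψ p =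
      Complex.I • ∑ j, (α j).mulVec
          (∫ p, fderiv ℝ (fun y => η (p.1, y)) p.2 (EuclideanSpace.single j 1) • ψ p)
        + β.mulVec (∫ p, (η p * (m - g * χ p)) • ψ p)
  kleinGordon : ∀ η : ℝ × EuclideanSpace ℝ (Fin n) → ℝ, ContDiff ℝ (⊤ : ℕ∞) η → HasCompactSupport η →
    ∫ p, (iteratedDeriv 2 (fun s => η (s, p.2)) p.1
        - Laplacian.laplacian (fun y => η (p.1, y)) p.2 + M ^ 2 * η p) * χ p =
      ∫ p, η p * diracDensity β (ψ p)

/-- `(φ(x) e^{-iωt}, h(x))` is a (nontrivial) solitary wave of the Dirac--Klein--Gordon system. -/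
structure IsDKGSolitaryWave {n N : ℕ} (α : Fin n → Matrix (Fin N) (Fin N) ℂ)
    (β : Matrix (Fin N) (Fin N) ℂ) (m g M ω : ℝ)
    (φ : EuclideanSpace ℝ (Fin n) → Fin N → ℂ) (h : EuclideanSpace ℝ (Fin n) → ℝ) : Prop where
  nontrivial : ¬ ∀ᵐ x, φ x = 0
  solution : IsDKGSolution α β m g M
    (fun p => Complex.exp (-(Complex.I * ω * p.1)) • φ p.2) (fun p => h p.2)

/-- `h` vanishes at infinity in the weak (measure-theoretic) sense: every set `{|h| > ε}` has
finite Lebesgue measure. This holds in particular if `h(x) → 0` as `|x| → ∞`. -/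
def VanishesAtInfinity {n : ℕ} (h : EuclideanSpace ℝ (Fin n) → ℝ) : Prop :=
  ∀ ε : ℝ, 0 < ε → volume {x | ε < |h x|} < ⊤

end

/-! Testing with products `a t * b x` removes the time variable: the phase cancels in the density,
so `h` is a bounded weak solution of `(-Δ + M²) h = φ̄φ ≤ 0`, while `D₀φ = ωφ - (m - g h)βφ`.

Mollifying `h` gives smooth bounded functions `u` with `M² u ≤ Δu`, open to classical maximum
principles. If `M > 0`, a quadratic penalty yields `u ≤ 0`; if `M = 0` and `n ≥ 3`, decay at
infinity does. If `M = 0` and `n ≤ 2`, Liouville's theorem for subharmonic functions makes `u`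
constant. Letting the mollification shrink, either `h ≤ 0` or `h` is constant almost everywhere.

If `h ≤ 0`, pair the Dirac equation with `βφ`. As `βD₀` is skew-adjoint, the real part is `0 = ω ∫
φ̄φ - ∫ (m - g h)|φ|²`; since `|φ̄φ| ≤ |φ|²`, this gives `(m - |ω|) ∫ |φ|² ≤ 0`, so `φ = 0`
(`false_of_ae_nonpos`). If `h = c`, then `φ` is an eigenfunction of the free Dirac operator with
mass `m - g c`. Squaring the symbol confines its Fourier transform to a null sphere, so again `φ =
0` (`false_of_ae_eq_const`). Both arguments use Plancherel, so `φ` needs no regularity beyond `L²`.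
-/

/-! ### Second derivatives and the Laplacian in coordinates. -/

section SecondDerivative

variable {E : Type*} [NormedAddCommGroup E] [NormedSpace ℝ E]

theorem hasDerivAt_add_smul (x v : E) (t : ℝ) : HasDerivAt (fun t : ℝ => x + t • v) v t := by
  have h := ((hasDerivAt_id t).smul_const v).const_add x
  rw [one_smul] at h
  exact h

theorem deriv_comp_add_smul {u : E → ℝ} (hu : Differentiable ℝ u) (x v : E) (t : ℝ) :
    deriv (fun t : ℝ => u (x + t • v)) t = fderiv ℝ u (x + t • v) v :=
  ((hu _).hasFDerivAt.comp_hasDerivAt t (hasDerivAt_add_smul x v t)).deriv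

theorem deriv_deriv_comp_add_smul {u : E → ℝ} (hu : ContDiff ℝ 2 u) (x v : E) :
    deriv (deriv fun t : ℝ => u (x + t • v)) 0 = fderiv ℝ (fun y => fderiv ℝ u y v) x v := by
  have hd : Differentiable ℝ fun y => fderiv ℝ u y v :=
    ((hu.fderiv_right (m := 1) (by norm_num)).clm_apply contDiff_const).differentiable
      (by norm_num)
  have h1 : (deriv fun t : ℝ => u (x + t • v)) = fun t : ℝ => fderiv ℝ u (x + t • v) v :=
    funext fun t => deriv_comp_add_smul (hu.differentiable (by norm_num)) x v t
  rw [h1, deriv_comp_add_smul hd, zero_smul, add_zero]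

theorem fderiv_fderiv_apply {u : E → ℝ} (hu : ContDiff ℝ 2 u) (x v : E) :
    fderiv ℝ (fun y => fderiv ℝ u y v) x v = fderiv ℝ (fderiv ℝ u) x v v := by
  have hd : DifferentiableAt ℝ (fderiv ℝ u) x :=
    (hu.fderiv_right (m := 1) (by norm_num)).differentiable (by norm_num) x
  rw [fderiv_clm_apply hd (differentiableAt_const v)]
  simp

end SecondDerivative

theorem laplacian_eq_sum_fderiv_fderiv {n : ℕ} {u : EuclideanSpace ℝ (Fin n) → ℝ}
    (hu : ContDiff ℝ 2 u) (x : EuclideanSpace ℝ (Fin n)) :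
    Laplacian.laplacian u x =
      ∑ j, fderiv ℝ (fun y => fderiv ℝ u y (EuclideanSpace.single j 1)) x
        (EuclideanSpace.single j 1) := by
  rw [InnerProductSpace.laplacian_eq_iteratedFDeriv_orthonormalBasis u
    (EuclideanSpace.basisFun (Fin n) ℝ)]
  refine Finset.sum_congr rfl fun j _ => ?_
  rw [iteratedFDeriv_two_apply, fderiv_fderiv_apply hu]
  simp

/-- The Laplacian is the sum of the second derivatives along the coordinate lines. -/
theorem laplacian_eq_sum_deriv_deriv {n : ℕ} {u : EuclideanSpace ℝ (Fin n) → ℝ}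
    (hu : ContDiff ℝ 2 u) (x : EuclideanSpace ℝ (Fin n)) :
    Laplacian.laplacian u x =
      ∑ j, deriv (deriv fun t : ℝ => u (x + t • EuclideanSpace.single j 1)) 0 := by
  rw [laplacian_eq_sum_fderiv_fderiv hu]
  exact Finset.sum_congr rfl fun j _ => (deriv_deriv_comp_add_smul hu x _).symm

/-- Were the second derivative positive, the point would also be a local minimum, so `g` would be
locally constant there and its second derivative zero. -/
theorem deriv_deriv_nonpos_of_isLocalMax {g : ℝ → ℝ} {t : ℝ} (hg : ContinuousAt g t)
    (h : IsLocalMax g t) : deriv (deriv g) t ≤ 0 := by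
  by_contra! hpos
  have hmin := isLocalMin_of_deriv_deriv_pos hpos h.deriv_eq_zero hg
  have hconst : g =ᶠ[nhds t] fun _ => g t := by
    filter_upwards [h, hmin] with s h1 h2 using le_antisymm h1 h2
  rw [hconst.deriv.deriv_eq] at hpos
  simp at hpos

theorem laplacian_nonpos_of_isLocalMax {n : ℕ} {w : EuclideanSpace ℝ (Fin n) → ℝ}
    (hw : ContDiff ℝ 2 w) {x : EuclideanSpace ℝ (Fin n)} (h : IsLocalMax w x) :
    Laplacian.laplacian w x ≤ 0 := by
  rw [laplacian_eq_sum_deriv_deriv hw]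
  refine Finset.sum_nonpos fun j _ => ?_
  have hc : Continuous fun t : ℝ =>
      x + t • (EuclideanSpace.single j 1 : EuclideanSpace ℝ (Fin n)) := by fun_prop
  refine deriv_deriv_nonpos_of_isLocalMax (hw.continuous.comp hc).continuousAt ?_
  have ht : Filter.Tendsto (fun t : ℝ =>
      x + t • (EuclideanSpace.single j 1 : EuclideanSpace ℝ (Fin n))) (nhds 0) (nhds x) := by
    simpa using hc.tendsto 0
  filter_upwards [ht.eventually h] with t ht
  simpa using ht

theorem laplacian_le_of_isLocalMax_sub {n : ℕ} {u s : EuclideanSpace ℝ (Fin n) → ℝ}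
    (hu : ContDiff ℝ 2 u) (hs : ContDiff ℝ 2 s) {x : EuclideanSpace ℝ (Fin n)}
    (h : IsLocalMax (u - s) x) : Laplacian.laplacian u x ≤ Laplacian.laplacian s x := by
  have h1 := laplacian_nonpos_of_isLocalMax (w := u - s) (hu.sub hs) h
  rw [ContDiffAt.laplacian_sub hu.contDiffAt hs.contDiffAt] at h1
  linarith

/-- For harmonic `u` only the gradient term remains; this turns "bounded subharmonic functions are
harmonic" into Liouville's theorem. -/
theorem laplacian_sq {n : ℕ} {u : EuclideanSpace ℝ (Fin n) → ℝ}
    (hu : ContDiff ℝ 2 u) (x : EuclideanSpace ℝ (Fin n)) :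
    Laplacian.laplacian (fun y => u y ^ 2) x =
      2 * u x * Laplacian.laplacian u x
        + 2 * ∑ j, (fderiv ℝ u x (EuclideanSpace.single j 1)) ^ 2 := by
  rw [laplacian_eq_sum_fderiv_fderiv hu, laplacian_eq_sum_fderiv_fderiv (hu.pow 2),
    Finset.mul_sum, Finset.mul_sum, ← Finset.sum_add_distrib]
  refine Finset.sum_congr rfl fun j _ => ?_
  generalize (EuclideanSpace.single j 1 : EuclideanSpace ℝ (Fin n)) = v
  have hdu : Differentiable ℝ u := hu.differentiable (by norm_num)
  have hd : Differentiable ℝ fun y => fderiv ℝ u y v :=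
    ((hu.fderiv_right (m := 1) (by norm_num)).clm_apply contDiff_const).differentiable
      (by norm_num)
  have h1 : (fun y => fderiv ℝ (fun y => u y ^ 2) y v) = fun y => 2 * (u y * fderiv ℝ u y v) := by
    funext y
    rw [((hdu y).hasFDerivAt.pow 2).fderiv]
    simp
    ring
  have h2 : HasFDerivAt (fun y => 2 * (u y * fderiv ℝ u y v)) _ x :=
    ((hdu x).hasFDerivAt.mul (hd x).hasFDerivAt).const_mul 2
  rw [h1, h2.fderiv]
  simp
  ring

/-- The Laplacian of a radial function `F (‖x - a‖²)`. -/
theorem laplacian_comp_norm_sub_sq {n : ℕ} {F F' : ℝ → ℝ} {F'' : ℝ}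
    (a x : EuclideanSpace ℝ (Fin n))
    (hs : ContDiff ℝ 2 fun y : EuclideanSpace ℝ (Fin n) => F (‖y - a‖ ^ 2))
    (h1 : ∀ t, 0 ≤ t → HasDerivAt F (F' t) t) (h2 : HasDerivAt F' F'' (‖x - a‖ ^ 2)) :
    Laplacian.laplacian (fun y : EuclideanSpace ℝ (Fin n) => F (‖y - a‖ ^ 2)) x =
      2 * n * F' (‖x - a‖ ^ 2) + 4 * ‖x - a‖ ^ 2 * F'' := by
  rw [laplacian_eq_sum_deriv_deriv hs]
  have key : ∀ j : Fin n,
      deriv (deriv fun t : ℝ => F (‖x + t • EuclideanSpace.single j 1 - a‖ ^ 2)) 0 =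
        2 * F' (‖x - a‖ ^ 2) + 4 * (x - a) j ^ 2 * F'' := by
    intro j
    have hq : ∀ t : ℝ, ‖x + t • EuclideanSpace.single j 1 - a‖ ^ 2 =
        ‖x - a‖ ^ 2 + 2 * (x - a) j * t + t ^ 2 := by
      intro t
      have h3 : x + t • EuclideanSpace.single j 1 - a =
          (x - a) + t • EuclideanSpace.single j 1 := by abel
      rw [h3, norm_add_sq_real, inner_smul_right, norm_smul, mul_pow,
        EuclideanSpace.inner_single_right]
      simp
      ring
    generalize (x - a) j = b at hq ⊢
    have hqd : ∀ t : ℝ, HasDerivAt (fun t : ℝ => ‖x - a‖ ^ 2 + 2 * b * t + t ^ 2)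
        (2 * b + 2 * t) t := by
      intro t
      have h3 := (((hasDerivAt_id t).const_mul (2 * b)).const_add (‖x - a‖ ^ 2)).add
        (hasDerivAt_pow 2 t)
      exact h3.congr_deriv (by simp)
    simp_rw [hq]
    -- Only nonnegative arguments of `F` occur; the logarithmic profile used below is singular at
    -- some negative ones.
    have hnn : ∀ t : ℝ, 0 ≤ ‖x - a‖ ^ 2 + 2 * b * t + t ^ 2 := fun t => by
      rw [← hq]; positivity
    have hd : (deriv fun t : ℝ => F (‖x - a‖ ^ 2 + 2 * b * t + t ^ 2)) =
        fun t : ℝ => F' (‖x - a‖ ^ 2 + 2 * b * t + t ^ 2) * (2 * b + 2 * t) := by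
      funext t
      exact ((h1 _ (hnn t)).comp t (hqd t)).deriv
    rw [hd]
    have h2' : HasDerivAt F' F'' (‖x - a‖ ^ 2 + 2 * b * 0 + 0 ^ 2) := by simpa using h2
    have h3 : HasDerivAt (fun t : ℝ => 2 * b + 2 * t) 2 0 := by
      simpa using ((hasDerivAt_id (0 : ℝ)).const_mul 2).const_add (2 * b)
    refine ((h2'.comp (0 : ℝ) (hqd 0)).mul h3).deriv.trans ?_
    simp
    ring
  simp_rw [key]
  have hnorm : ‖x - a‖ ^ 2 = ∑ j, (x - a) j ^ 2 := by
    rw [EuclideanSpace.norm_sq_eq]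
    simp
  have hsum : ∑ j, 4 * (x - a) j ^ 2 * F'' = 4 * ‖x - a‖ ^ 2 * F'' := by
    rw [← Finset.sum_mul, ← Finset.mul_sum, ← hnorm]
  rw [Finset.sum_add_distrib, hsum]
  simp
  ring

/-! ### Maximum principles on the whole space. -/

/-- A penalty `s` that keeps `u - s` below its value at `x₀` near infinity forces a global maximum,
where the Laplacians compare. -/
theorem exists_laplacian_le_of_eventually {n : ℕ} {u s : EuclideanSpace ℝ (Fin n) → ℝ}
    (hu : ContDiff ℝ 2 u) (hs : ContDiff ℝ 2 s) (x₀ : EuclideanSpace ℝ (Fin n))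
    (h : ∀ᶠ x in Filter.cocompact _, u x - s x ≤ u x₀ - s x₀) :
    ∃ x, u x₀ - s x₀ ≤ u x - s x ∧ Laplacian.laplacian u x ≤ Laplacian.laplacian s x := by
  obtain ⟨x, hx⟩ := (hu.sub hs).continuous.exists_forall_ge' x₀ h
  exact ⟨x, hx x₀, laplacian_le_of_isLocalMax_sub hu hs (Filter.Eventually.of_forall hx)⟩

theorem tendsto_norm_sub_sq_cocompact {n : ℕ} (a : EuclideanSpace ℝ (Fin n)) :
    Filter.Tendsto (fun x : EuclideanSpace ℝ (Fin n) => ‖x - a‖ ^ 2)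
      (Filter.cocompact _) Filter.atTop :=
  (Filter.tendsto_pow_atTop two_ne_zero).comp ((tendsto_norm_cocompact_atTop).comp
    (Homeomorph.subRight a).isClosedEmbedding.tendsto_cocompact)

theorem contDiff_norm_sub_sq {n : ℕ} (a : EuclideanSpace ℝ (Fin n)) :
    ContDiff ℝ 2 fun x : EuclideanSpace ℝ (Fin n) => ‖x - a‖ ^ 2 :=
  (contDiff_id.sub contDiff_const).norm_sq ℝ

theorem laplacian_const_mul_norm_sub_sq {n : ℕ} (δ : ℝ) (a x : EuclideanSpace ℝ (Fin n)) :
    Laplacian.laplacian (fun y : EuclideanSpace ℝ (Fin n) => δ * ‖y - a‖ ^ 2) x = 2 * n * δ := by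
  have h := laplacian_comp_norm_sub_sq (F := fun t => δ * t) (F' := fun _ => δ) (F'' := 0) a x
    (contDiff_const.mul (contDiff_norm_sub_sq a))
    (fun t _ => by simpa using (hasDerivAt_id t).const_mul δ) (hasDerivAt_const _ _)
  simpa using h

/-- Penalize by `δ‖x - x₀‖²`: at the maximum point, `c * u x₀ ≤ c * u x ≤ Δu x ≤ 2nδ`, which fails
for small `δ` if `u x₀ > 0`. -/
theorem nonpos_of_mul_le_laplacian {n : ℕ} {u : EuclideanSpace ℝ (Fin n) → ℝ}
    (hu : ContDiff ℝ 2 u) {K c : ℝ} (hc : 0 < c) (hK : ∀ x, |u x| ≤ K)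
    (hΔ : ∀ x, c * u x ≤ Laplacian.laplacian u x) (x₀ : EuclideanSpace ℝ (Fin n)) :
    u x₀ ≤ 0 := by
  by_contra! hpos
  -- Chosen so that `2 * n * δ < c * u x₀`.
  set δ : ℝ := c * u x₀ / (2 * n + 1) with hδ
  have hδ0 : 0 < δ := by positivity
  have hev : ∀ᶠ x in Filter.cocompact (EuclideanSpace ℝ (Fin n)),
      u x - δ * ‖x - x₀‖ ^ 2 ≤ u x₀ - δ * ‖x₀ - x₀‖ ^ 2 := by
    filter_upwards [((tendsto_norm_sub_sq_cocompact x₀).const_mul_atTop hδ0).eventually_ge_atTop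
      (2 * K)] with x hx
    have h1 := abs_le.1 (hK x)
    have h2 := abs_le.1 (hK x₀)
    simp only [sub_self, norm_zero]
    linarith
  obtain ⟨x, hx1, hx2⟩ := exists_laplacian_le_of_eventually hu
    (contDiff_const.mul (contDiff_norm_sub_sq x₀)) x₀ hev
  rw [laplacian_const_mul_norm_sub_sq] at hx2
  have h3 : u x₀ ≤ u x := by
    have : 0 ≤ δ * ‖x - x₀‖ ^ 2 := by positivity
    simp only [sub_self, norm_zero] at hx1
    linarith
  have h4 : δ * (2 * n + 1) = c * u x₀ := by rw [hδ]; field_simp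
  nlinarith [hΔ x, mul_le_mul_of_nonneg_left h3 hc.le]

/-- Adding `δ‖x‖²` makes `u` strictly subharmonic (here `n ≥ 1` enters), so its maximum over a large
ball cannot be interior; on the boundary `u` is too small. -/
theorem nonpos_of_laplacian_nonneg_of_eventually_le {n : ℕ} (hn : 1 ≤ n)
    {u : EuclideanSpace ℝ (Fin n) → ℝ} (hu : ContDiff ℝ 2 u)
    (hΔ : ∀ x, 0 ≤ Laplacian.laplacian u x)
    (hdecay : ∀ κ, 0 < κ → ∀ᶠ x in Filter.cocompact _, u x ≤ κ)
    (x₀ : EuclideanSpace ℝ (Fin n)) : u x₀ ≤ 0 := by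
  by_contra! hpos
  obtain ⟨R, hR⟩ : ∃ R : ℝ, ∀ x : EuclideanSpace ℝ (Fin n), R < ‖x‖ → u x ≤ u x₀ / 2 := by
    have h := hdecay _ (half_pos hpos)
    rw [← Metric.cobounded_eq_cocompact, ← comap_norm_atTop, Filter.eventually_comap] at h
    obtain ⟨R, hR⟩ := Filter.eventually_atTop.1 h
    exact ⟨R, fun x hx => hR _ hx.le x rfl⟩
  set R' := max R ‖x₀‖ + 1 with hR'
  have hRR' : R < R' := by rw [hR']; linarith [le_max_left R ‖x₀‖]
  have hx₀R' : ‖x₀‖ < R' := by rw [hR']; linarith [le_max_right R ‖x₀‖]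
  have hR'0 : 0 < R' := (norm_nonneg _).trans_lt hx₀R'
  -- The added term is at most `u x₀ / 4` on the ball, so on its boundary the sum is at most `3/4 *
  -- u x₀`.
  set δ : ℝ := u x₀ / (4 * R' ^ 2) with hδ
  have hδ0 : 0 < δ := by positivity
  have hδR : δ * R' ^ 2 = u x₀ / 4 := by rw [hδ]; field_simp
  have hs : ContDiff ℝ 2 fun y : EuclideanSpace ℝ (Fin n) => -δ * ‖y - 0‖ ^ 2 :=
    contDiff_const.mul (contDiff_norm_sub_sq 0)
  obtain ⟨x, hx, hmax⟩ := (isCompact_closedBall (0 : EuclideanSpace ℝ (Fin n)) R').exists_isMaxOn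
    ⟨x₀, by simpa using hx₀R'.le⟩ (hu.sub hs).continuous.continuousOn
  have h0 : u x₀ ≤ u x + δ * ‖x‖ ^ 2 := by
    have h1 : u x₀ - -δ * ‖x₀ - 0‖ ^ 2 ≤ u x - -δ * ‖x - 0‖ ^ 2 :=
      hmax (by simpa using hx₀R'.le)
    have : 0 ≤ δ * ‖x₀‖ ^ 2 := by positivity
    simp only [sub_zero] at h1
    linarith
  have hxle : ‖x‖ ≤ R' := by simpa using hx
  have hxR : ‖x‖ < R' := by
    refine hxle.lt_of_ne fun h => ?_
    have h1 := hR x (by rw [h]; exact hRR')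
    rw [h, hδR] at h0
    linarith
  have hloc : IsLocalMax (u - fun y : EuclideanSpace ℝ (Fin n) => -δ * ‖y - 0‖ ^ 2) x := by
    refine hmax.isLocalMax ?_
    exact Filter.mem_of_superset (Metric.isOpen_ball.mem_nhds (by simpa using hxR))
      Metric.ball_subset_closedBall
  have h2 := laplacian_le_of_isLocalMax_sub hu hs hloc
  rw [laplacian_const_mul_norm_sub_sq] at h2
  have h3 : (1 : ℝ) ≤ n := by exact_mod_cast hn
  nlinarith [hΔ x]

/-! ### Liouville's theorem in dimension at most two. -/

/-- The profile of a radial function that is superharmonic away from the origin and tends to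
infinity in dimension at most two. -/
theorem log_one_add_log_profile {e : ℝ} (he : 0 < e) (t : ℝ) (ht : 0 ≤ t) :
    HasDerivAt (fun t => Real.log (1 + Real.log (1 + t / e)))
      (1 / ((1 + Real.log (1 + t / e)) * (e + t))) t ∧
    HasDerivAt (fun t => 1 / ((1 + Real.log (1 + t / e)) * (e + t)))
      (-(2 + Real.log (1 + t / e)) / ((1 + Real.log (1 + t / e)) * (e + t)) ^ 2) t := by
  have h1 : 1 ≤ 1 + t / e := by
    have := div_nonneg ht he.le
    linarith
  have hL : 0 ≤ Real.log (1 + t / e) := Real.log_nonneg h1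
  have hL' : HasDerivAt (fun t => 1 + Real.log (1 + t / e)) (1 / (e + t)) t := by
    have h2 := ((((hasDerivAt_id t).div_const e).const_add 1).log
      (by simp only [id]; linarith)).const_add 1
    refine h2.congr_deriv ?_
    simp only [id]
    field_simp
  refine ⟨(hL'.log (by linarith)).congr_deriv (by field_simp), ?_⟩
  have h2 : HasDerivAt (fun t => (1 + Real.log (1 + t / e)) * (e + t))
      (1 / (e + t) * (e + t) + (1 + Real.log (1 + t / e)) * 1) t :=
    hL'.mul ((hasDerivAt_id t).const_add e)
  have h3 := h2.fun_inv (by positivity)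
  simp_rw [one_div ((_ : ℝ) * _)]
  refine h3.congr_deriv ?_
  have : e + t ≠ 0 := by positivity
  congr 1
  field_simp
  ring

/-- Bound the logarithm by its tangent line at `4`, that is at `τ = 3`, which has slope `1/4`. -/
theorem one_add_log_lt {τ : ℝ} (hτ : 3 ≤ τ) : 1 + Real.log (1 + τ) < τ := by
  have h1 : Real.log (1 + τ) = Real.log 4 + Real.log ((1 + τ) / 4) := by
    rw [← Real.log_mul (by norm_num) (by positivity)]
    congr 1
    ring
  have h2 : Real.log 4 = 2 * Real.log 2 := by
    rw [show (4 : ℝ) = 2 ^ 2 by norm_num, Real.log_pow]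
    norm_num
  have h3 := Real.log_le_sub_one_of_pos (show 0 < (1 + τ) / 4 by positivity)
  have h4 := Real.log_two_lt_d9
  linarith

/-- In dimension two a single `log (1 + ‖y - a‖² / e)` has positive Laplacian. A second logarithm
makes it negative far out, and the function still tends to infinity. With `t = ‖x - a‖²` and `L =
log (1 + t / e)`, the Laplacian is at most `4(e(1 + L) - t) / ((1 + L)(e + t))²`. -/
theorem laplacian_log_one_add_log_le {n : ℕ} (hn : n ≤ 2) {e : ℝ} (he : 0 < e)
    (a x : EuclideanSpace ℝ (Fin n)) :
    ContDiff ℝ 2 (fun y : EuclideanSpace ℝ (Fin n) =>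
      Real.log (1 + Real.log (1 + ‖y - a‖ ^ 2 / e))) ∧
    Laplacian.laplacian (fun y : EuclideanSpace ℝ (Fin n) =>
      Real.log (1 + Real.log (1 + ‖y - a‖ ^ 2 / e))) x ≤ 4 / e ∧
    (3 * e ≤ ‖x - a‖ ^ 2 → Laplacian.laplacian (fun y : EuclideanSpace ℝ (Fin n) =>
      Real.log (1 + Real.log (1 + ‖y - a‖ ^ 2 / e))) x < 0) := by
  have h1 : ∀ y : EuclideanSpace ℝ (Fin n), 1 ≤ 1 + ‖y - a‖ ^ 2 / e := fun y => by
    have : 0 ≤ ‖y - a‖ ^ 2 / e := by positivity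
    linarith
  have hs : ContDiff ℝ 2 (fun y : EuclideanSpace ℝ (Fin n) =>
      Real.log (1 + Real.log (1 + ‖y - a‖ ^ 2 / e))) := by
    refine ContDiff.log (contDiff_const.add (ContDiff.log (contDiff_const.add
      ((contDiff_norm_sub_sq a).div_const e)) fun y => ?_)) fun y => ?_
    · linarith [h1 y]
    · linarith [Real.log_nonneg (h1 y)]
  have hΔ := laplacian_comp_norm_sub_sq (F := fun t => Real.log (1 + Real.log (1 + t / e)))
    (F' := fun t => 1 / ((1 + Real.log (1 + t / e)) * (e + t))) a x hs
    (fun t ht => (log_one_add_log_profile he t ht).1)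
    (log_one_add_log_profile he _ (sq_nonneg _)).2
  have hL := Real.log_nonneg (h1 x)
  have h3 : 3 * e ≤ ‖x - a‖ ^ 2 → e * (1 + Real.log (1 + ‖x - a‖ ^ 2 / e)) < ‖x - a‖ ^ 2 := by
    intro h
    have := one_add_log_lt ((le_div_iff₀ he).2 h)
    rwa [lt_div_iff₀ he, mul_comm] at this
  have hn' : (n : ℝ) ≤ 2 := by exact_mod_cast hn
  have ht := sq_nonneg ‖x - a‖
  refine ⟨hs, ?_⟩
  rw [hΔ]
  clear hΔ
  generalize Real.log (1 + ‖x - a‖ ^ 2 / e) = L at hL h3 ⊢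
  generalize ‖x - a‖ ^ 2 = t at ht h3 ⊢
  have hD : 0 < (1 + L) * (e + t) := by positivity
  have hle : 2 * n * (1 / ((1 + L) * (e + t))) + 4 * t * (-(2 + L) / ((1 + L) * (e + t)) ^ 2)
      ≤ 4 * (e * (1 + L) - t) / ((1 + L) * (e + t)) ^ 2 := by
    have h5 : 2 * n * (1 / ((1 + L) * (e + t))) ≤ 4 * (1 / ((1 + L) * (e + t))) := by
      have : 0 ≤ 1 / ((1 + L) * (e + t)) := by positivity
      nlinarith
    refine (add_le_add_left h5 _).trans (le_of_eq ?_)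
    field_simp
    ring
  refine ⟨hle.trans ?_, fun h => hle.trans_lt ?_⟩
  · rw [div_le_div_iff₀ (by positivity) he]
    have h6 : e * (1 + L) * e ≤ ((1 + L) * (e + t)) ^ 2 := by
      have h7 : e * 1 ≤ (e + t) * (1 + L) := by
        apply mul_le_mul <;> linarith
      nlinarith [mul_nonneg hL (mul_nonneg he.le ht), mul_nonneg hL he.le, mul_nonneg he.le ht,
        mul_nonneg (mul_nonneg he.le he.le) hL, mul_le_mul_of_nonneg_left h7 hD.le,
        mul_nonneg hL ht]
    nlinarith
  · apply div_neg_of_neg_of_pos _ (by positivity)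
    linarith [h3 h]

theorem continuous_laplacian {n : ℕ} {u : EuclideanSpace ℝ (Fin n) → ℝ} (hu : ContDiff ℝ 2 u) :
    Continuous (Laplacian.laplacian u) := by
  have h : Laplacian.laplacian u = fun x =>
      ∑ j, fderiv ℝ (fun y => fderiv ℝ u y (EuclideanSpace.single j 1)) x
        (EuclideanSpace.single j 1) := funext (laplacian_eq_sum_fderiv_fderiv hu)
  rw [h]
  refine continuous_finsetSum _ fun j _ => ?_
  have h1 : ContDiff ℝ 1 fun y => fderiv ℝ u y (EuclideanSpace.single j 1) :=
    (hu.fderiv_right (m := 1) (by norm_num)).clm_apply contDiff_const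
  exact (h1.continuous_fderiv (by norm_num)).clm_apply continuous_const

/-- If `Δu x₀ > 0`, subtract a small multiple of the double logarithm. At a maximum point `Δu` is at
most the Laplacian of the penalty, but far from `x₀` the latter is negative, and near `x₀` it is
smaller than `Δu`. -/
theorem laplacian_eq_zero_of_bounded_of_nonneg {n : ℕ} (hn : n ≤ 2)
    {u : EuclideanSpace ℝ (Fin n) → ℝ} (hu : ContDiff ℝ 2 u) {K : ℝ} (hK : ∀ x, |u x| ≤ K)
    (hΔ : ∀ x, 0 ≤ Laplacian.laplacian u x) (x₀ : EuclideanSpace ℝ (Fin n)) :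
    Laplacian.laplacian u x₀ = 0 := by
  refine le_antisymm ?_ (hΔ x₀)
  by_contra! hpos
  have hnear : ∀ᶠ x in nhds x₀, Laplacian.laplacian u x₀ / 2 < Laplacian.laplacian u x :=
    (continuous_laplacian hu).continuousAt.eventually_const_lt (half_lt_self hpos)
  obtain ⟨r, hr, hball⟩ := Metric.eventually_nhds_iff.1 hnear
  set c := Laplacian.laplacian u x₀ with hc
  -- Then `3 * e < r ^ 2`: outside the ball of radius `r` the penalty is strictly superharmonic.
  set e : ℝ := r ^ 2 / 4 with he
  have he0 : 0 < e := by positivity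
  -- The penalty's Laplacian is then at most `δ * (4 / e) = c / 4`, below the lower bound `c / 2`
  -- for `Δu` on the ball.
  set δ : ℝ := c * e / 16 with hδ
  have hδ0 : 0 < δ := by positivity
  have hev : ∀ᶠ x in Filter.cocompact (EuclideanSpace ℝ (Fin n)),
      u x - (δ • fun y : EuclideanSpace ℝ (Fin n) =>
        Real.log (1 + Real.log (1 + ‖y - x₀‖ ^ 2 / e))) x ≤
      u x₀ - (δ • fun y : EuclideanSpace ℝ (Fin n) =>
        Real.log (1 + Real.log (1 + ‖y - x₀‖ ^ 2 / e))) x₀ := by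
    have hlim : Filter.Tendsto (fun x : EuclideanSpace ℝ (Fin n) =>
        δ * Real.log (1 + Real.log (1 + ‖x - x₀‖ ^ 2 / e))) (Filter.cocompact _) Filter.atTop :=
      (Real.tendsto_log_atTop.comp (Filter.tendsto_atTop_add_const_left _ _
        (Real.tendsto_log_atTop.comp (Filter.tendsto_atTop_add_const_left _ _
          ((tendsto_norm_sub_sq_cocompact x₀).atTop_div_const he0))))).const_mul_atTop hδ0
    filter_upwards [hlim.eventually_ge_atTop (2 * K)] with x hx
    have h1 := abs_le.1 (hK x)
    have h2 := abs_le.1 (hK x₀)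
    simp only [Pi.smul_apply, smul_eq_mul, sub_self, norm_zero]
    norm_num
    linarith
  have hs := (laplacian_log_one_add_log_le hn he0 x₀ x₀).1
  obtain ⟨x, -, hx⟩ := exists_laplacian_le_of_eventually hu
    (s := δ • fun y : EuclideanSpace ℝ (Fin n) => Real.log (1 + Real.log (1 + ‖y - x₀‖ ^ 2 / e)))
    (hs.const_smul δ) x₀ hev
  rw [InnerProductSpace.laplacian_smul δ hs.contDiffAt, smul_eq_mul] at hx
  obtain ⟨-, h1, h2⟩ := laplacian_log_one_add_log_le hn he0 x₀ x
  by_cases hfar : 3 * e ≤ ‖x - x₀‖ ^ 2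
  · nlinarith [h2 hfar, hΔ x]
  · have hdist : dist x x₀ < r := by
      rw [dist_eq_norm]
      refine lt_of_pow_lt_pow_left₀ 2 hr.le ?_
      rw [he] at hfar
      nlinarith
    have h3 := hball hdist
    have h4 : δ * (4 / e) = c / 4 := by rw [hδ]; field_simp; norm_num
    have h5 := mul_le_mul_of_nonneg_left h1 hδ0.le
    linarith

/-- **Liouville's theorem** in dimension at most two: bounded subharmonic functions are
constant. -/
theorem eq_of_bounded_of_laplacian_nonneg {n : ℕ} (hn : n ≤ 2)
    {u : EuclideanSpace ℝ (Fin n) → ℝ} (hu : ContDiff ℝ 2 u) {K : ℝ} (hK : ∀ x, |u x| ≤ K)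
    (hΔ : ∀ x, 0 ≤ Laplacian.laplacian u x) (x y : EuclideanSpace ℝ (Fin n)) : u x = u y := by
  have h0 := laplacian_eq_zero_of_bounded_of_nonneg hn hu hK hΔ
  have hsq : ∀ x, Laplacian.laplacian (fun y => u y ^ 2) x =
      2 * ∑ j, (fderiv ℝ u x (EuclideanSpace.single j 1)) ^ 2 := fun x => by
    rw [laplacian_sq hu, h0, mul_zero, zero_add]
  -- The square is again bounded and subharmonic, hence harmonic, so the gradient of `u` vanishes.
  have h1 := laplacian_eq_zero_of_bounded_of_nonneg hn (hu.pow 2) (K := K ^ 2)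
    (fun x => by rw [abs_pow]; exact pow_le_pow_left₀ (abs_nonneg _) (hK x) 2)
    (fun x => by rw [hsq]; positivity)
  refine is_const_of_fderiv_eq_zero (𝕜 := ℝ) (hu.differentiable (by norm_num)) (fun x => ?_) x y
  have h2 : ∑ j, (fderiv ℝ u x (EuclideanSpace.single j 1)) ^ 2 = 0 := by
    have := (hsq x).symm.trans (h1 x)
    linarith
  rw [Finset.sum_eq_zero_iff_of_nonneg fun j _ => sq_nonneg _] at h2
  refine ContinuousLinearMap.coe_injective
    ((EuclideanSpace.basisFun (Fin n) ℝ).toBasis.ext fun j => ?_)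
  simpa using h2 j (Finset.mem_univ j)

/-! ### Mollification of weak solutions. -/

noncomputable section Mollification

open scoped Convolution ContDiff

/-- The convolution `x ↦ ∫ k (x - t) h (t) dt` of a scalar kernel with a function. -/
def kernelConvolution {n : ℕ} (k h : EuclideanSpace ℝ (Fin n) → ℝ) :
    EuclideanSpace ℝ (Fin n) → ℝ :=
  h ⋆[(ContinuousLinearMap.lsmul ℝ ℝ).flip, volume] k

section KernelConvolution

variable {n : ℕ} {k h : EuclideanSpace ℝ (Fin n) → ℝ}

theorem kernelConvolution_apply (k h : EuclideanSpace ℝ (Fin n) → ℝ)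
    (x : EuclideanSpace ℝ (Fin n)) : kernelConvolution k h x = ∫ t, k (x - t) * h t := rfl

theorem kernelConvolution_eq_convolution (k h : EuclideanSpace ℝ (Fin n) → ℝ) :
    kernelConvolution k h = k ⋆[ContinuousLinearMap.lsmul ℝ ℝ, volume] h :=
  convolution_flip _

theorem contDiff_kernelConvolution (hk : ContDiff ℝ ∞ k) (hkc : HasCompactSupport k)
    (hh : LocallyIntegrable h volume) : ContDiff ℝ ∞ (kernelConvolution k h) :=
  hkc.contDiff_convolution_right _ hh hk

theorem fderiv_kernelConvolution (hk : ContDiff ℝ ∞ k) (hkc : HasCompactSupport k)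
    (hh : LocallyIntegrable h volume) (x v : EuclideanSpace ℝ (Fin n)) :
    fderiv ℝ (kernelConvolution k h) x v = kernelConvolution (fun y => fderiv ℝ k y v) h x := by
  have hk1 : ContDiff ℝ 1 k := hk.of_le (by exact_mod_cast le_top)
  have h1 := hkc.hasFDerivAt_convolution_right (ContinuousLinearMap.lsmul ℝ ℝ).flip hh hk1 x
  have h2 : fderiv ℝ (kernelConvolution k h) x = _ := h1.fderiv
  rw [h2]
  exact convolution_precompR_apply _ hh (hkc.fderiv ℝ) (hk1.continuous_fderiv (by norm_num)) x v

theorem contDiff_fderiv_apply_const (hk : ContDiff ℝ ∞ k) (v : EuclideanSpace ℝ (Fin n)) :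
    ContDiff ℝ ∞ fun y => fderiv ℝ k y v :=
  (hk.fderiv_right (m := ∞) (by simp)).clm_apply contDiff_const

theorem integrable_mul_of_hasCompactSupport (hk : Continuous k) (hkc : HasCompactSupport k)
    (hh : LocallyIntegrable h volume) : Integrable (fun t => k t * h t) volume :=
  hh.integrable_smul_left_of_hasCompactSupport hk hkc

theorem hasCompactSupport_comp_const_sub (hkc : HasCompactSupport k)
    (x : EuclideanSpace ℝ (Fin n)) : HasCompactSupport fun t => k (x - t) :=
  hkc.comp_homeomorph (Homeomorph.subLeft x)

theorem fderiv_comp_const_sub (hk : ContDiff ℝ ∞ k) (x t v : EuclideanSpace ℝ (Fin n)) :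
    fderiv ℝ (fun t => k (x - t)) t v = -fderiv ℝ k (x - t) v := by
  have h1 : HasFDerivAt (fun t => x - t)
      (-ContinuousLinearMap.id ℝ (EuclideanSpace ℝ (Fin n))) t :=
    (hasFDerivAt_id t).const_sub x
  have h2 := ((hk.differentiable (by simp) (x - t)).hasFDerivAt.comp t h1).fderiv
  have h3 : fderiv ℝ (fun t => k (x - t)) t = _ := h2
  rw [h3]
  simp

theorem contDiff_two_of_contDiff_top (hk : ContDiff ℝ ∞ k) : ContDiff ℝ 2 k :=
  hk.of_le (by norm_cast)

theorem laplacian_comp_const_sub (hk : ContDiff ℝ ∞ k) (x t : EuclideanSpace ℝ (Fin n)) :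
    Laplacian.laplacian (fun t => k (x - t)) t = Laplacian.laplacian k (x - t) := by
  have hs : ContDiff ℝ ∞ fun t => k (x - t) := hk.comp (contDiff_const.sub contDiff_id)
  rw [laplacian_eq_sum_fderiv_fderiv (contDiff_two_of_contDiff_top hs),
    laplacian_eq_sum_fderiv_fderiv (contDiff_two_of_contDiff_top hk)]
  refine Finset.sum_congr rfl fun j _ => ?_
  generalize (EuclideanSpace.single j 1 : EuclideanSpace ℝ (Fin n)) = v
  simp_rw [fderiv_comp_const_sub hk]
  rw [fderiv_fun_neg, neg_apply,
    fderiv_comp_const_sub (k := fun y => fderiv ℝ k y v) (contDiff_fderiv_apply_const hk v),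
    neg_neg]

theorem hasCompactSupport_laplacian (hkc : HasCompactSupport k) :
    HasCompactSupport (Laplacian.laplacian k) := by
  refine hkc.mono' fun x hx => ?_
  by_contra hx'
  refine hx ?_
  have h0 : k =ᶠ[nhds x] fun _ => 0 := notMem_tsupport_iff_eventuallyEq.1 hx'
  rw [(InnerProductSpace.laplacian_congr_nhds h0).eq_of_nhds]
  simp

/-- The derivatives fall on the kernel. The right side is written with the test function `t ↦ k (x -
t)`, ready for the weak equation. -/
theorem laplacian_kernelConvolution (hk : ContDiff ℝ ∞ k) (hkc : HasCompactSupport k)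
    (hh : LocallyIntegrable h volume) (x : EuclideanSpace ℝ (Fin n)) :
    Laplacian.laplacian (kernelConvolution k h) x =
      ∫ t, Laplacian.laplacian (fun t => k (x - t)) t * h t := by
  rw [laplacian_eq_sum_fderiv_fderiv
    (contDiff_two_of_contDiff_top (contDiff_kernelConvolution hk hkc hh))]
  simp_rw [laplacian_comp_const_sub hk,
    laplacian_eq_sum_fderiv_fderiv (contDiff_two_of_contDiff_top hk), Finset.sum_mul]
  have hv : ∀ v : EuclideanSpace ℝ (Fin n), HasCompactSupport fun y => fderiv ℝ k y v :=
    fun v => hkc.fderiv_apply ℝ v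
  have hvv : ∀ v : EuclideanSpace ℝ (Fin n), ContDiff ℝ ∞ fun y =>
      fderiv ℝ (fun y => fderiv ℝ k y v) y v := fun v =>
    contDiff_fderiv_apply_const (contDiff_fderiv_apply_const hk v) v
  have hvvc : ∀ v : EuclideanSpace ℝ (Fin n), HasCompactSupport fun y =>
      fderiv ℝ (fun y => fderiv ℝ k y v) y v := fun v => (hv v).fderiv_apply ℝ v
  rw [integral_finsetSum]
  · refine Finset.sum_congr rfl fun j _ => ?_
    generalize (EuclideanSpace.single j 1 : EuclideanSpace ℝ (Fin n)) = v
    rw [funext fun y => fderiv_kernelConvolution hk hkc hh y v,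
      fderiv_kernelConvolution (contDiff_fderiv_apply_const hk v) (hv v) hh]
    rfl
  · intro j _
    exact integrable_mul_of_hasCompactSupport
      ((hvv _).continuous.comp (continuous_const.sub continuous_id))
      (hasCompactSupport_comp_const_sub (hvvc _) x) hh

/-- Testing with `t ↦ k (x - t)` gives `Δ(k * h) = c (k * h) - k * ρ`, and the last convolution is
nonpositive. -/
theorem mul_kernelConvolution_le_laplacian (hk : ContDiff ℝ ∞ k) (hkc : HasCompactSupport k)
    (hk0 : ∀ x, 0 ≤ k x) (hh : LocallyIntegrable h volume)
    {ρ : EuclideanSpace ℝ (Fin n) → ℝ} (hρ : ∀ᵐ x, ρ x ≤ 0) {c : ℝ}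
    (hweak : ∀ η : EuclideanSpace ℝ (Fin n) → ℝ, ContDiff ℝ ∞ η → HasCompactSupport η →
      ∫ x, (-Laplacian.laplacian η x + c * η x) * h x = ∫ x, η x * ρ x)
    (x : EuclideanSpace ℝ (Fin n)) :
    c * kernelConvolution k h x ≤ Laplacian.laplacian (kernelConvolution k h) x := by
  have hs : ContDiff ℝ ∞ fun t => k (x - t) := hk.comp (contDiff_const.sub contDiff_id)
  have hsc := hasCompactSupport_comp_const_sub hkc x
  have h1 := hweak _ hs hsc
  -- This needs no integrability of `ρ`: the integral of a nonintegrable function is `0` by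
  -- convention.
  have h2 : ∫ t, k (x - t) * ρ t ≤ 0 := by
    refine integral_nonpos_of_ae ?_
    filter_upwards [hρ] with t ht
    exact mul_nonpos_of_nonneg_of_nonpos (hk0 _) ht
  have hi1 := integrable_mul_of_hasCompactSupport
    (continuous_laplacian (contDiff_two_of_contDiff_top hs)) (hasCompactSupport_laplacian hsc) hh
  have hi2 := integrable_mul_of_hasCompactSupport hs.continuous hsc hh
  have h3 : ∫ t, (-Laplacian.laplacian (fun t => k (x - t)) t + c * k (x - t)) * h t =
      -(∫ t, Laplacian.laplacian (fun t => k (x - t)) t * h t) + c * ∫ t, k (x - t) * h t := by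
    rw [← integral_neg, ← integral_const_mul]
    refine Eq.trans ?_ (integral_add hi1.neg (hi2.const_mul c))
    congr 1 with t
    ring
  rw [laplacian_kernelConvolution hk hkc hh, kernelConvolution_apply]
  linarith

theorem abs_kernelConvolution_le (hk0 : ∀ x, 0 ≤ k x) (hk : Continuous k)
    (hkc : HasCompactSupport k) (hk1 : ∫ x, k x = 1) {K : ℝ} (hK : ∀ᵐ x, |h x| ≤ K)
    (x : EuclideanSpace ℝ (Fin n)) : |kernelConvolution k h x| ≤ K := by
  rw [kernelConvolution_apply]
  have hi : Integrable (fun t => k (x - t)) volume :=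
    (hk.integrable_of_hasCompactSupport hkc).comp_sub_left x
  rw [← Real.norm_eq_abs]
  refine (norm_integral_le_of_norm_le (hi.mul_const K) ?_).trans (le_of_eq ?_)
  · filter_upwards [hK] with t ht
    rw [norm_mul, Real.norm_of_nonneg (hk0 _)]
    exact mul_le_mul_of_nonneg_left ht (hk0 _)
  · rw [integral_mul_const, integral_sub_left_eq_self k volume x, hk1, one_mul]

/-- Split at `|h| = κ / 2`. Small values contribute at most `κ / 2`; large ones live on a set of
finite measure, which the translated kernel leaves as `x → ∞`, so their contribution vanishes by
dominated convergence. -/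
theorem eventually_kernelConvolution_le (hk0 : ∀ x, 0 ≤ k x) (hk : Continuous k)
    (hkc : HasCompactSupport k) (hk1 : ∫ x, k x = 1)
    (hh : LocallyIntegrable h volume) {K : ℝ} (hK : ∀ᵐ x, |h x| ≤ K) (hv : VanishesAtInfinity h) {κ : ℝ} (hκ : 0 < κ) :
    ∀ᶠ x in Filter.cocompact _, kernelConvolution k h x ≤ κ := by
  -- The set itself may fail to be measurable; its hull has the same measure.
  set A := toMeasurable volume {x | κ / 2 < |h x|} with hA
  have hAm : MeasurableSet A := measurableSet_toMeasurable _ _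
  have hAfin : volume A ≠ ⊤ := by
    rw [hA, measure_toMeasurable]
    exact (hv _ (half_pos hκ)).ne
  obtain ⟨C, hC⟩ := hk.bounded_above_of_compact_support hkc
  obtain ⟨R, hR⟩ := (hkc.isCompact.isBounded).exists_norm_le
  have hi : ∀ x, Integrable (fun t => k (x - t)) volume := fun x =>
    (hk.integrable_of_hasCompactSupport hkc).comp_sub_left x
  have hlim : Filter.Tendsto (fun x => ∫ t, K * (A.indicator (fun t => k (x - t)) t))
      (Filter.cocompact _) (nhds (∫ _ : EuclideanSpace ℝ (Fin n), (0 : ℝ))) := by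
    have : (Filter.cocompact (EuclideanSpace ℝ (Fin n))).IsCountablyGenerated := by
      rw [← Metric.cobounded_eq_cocompact, ← comap_norm_atTop]
      infer_instance
    refine tendsto_integral_filter_of_dominated_convergence
      (fun t => A.indicator (fun _ => |K| * C) t) ?_ ?_ ?_ ?_
    · exact Filter.Eventually.of_forall fun x =>
        (((hi x).indicator hAm).const_mul K).aestronglyMeasurable
    · refine Filter.Eventually.of_forall fun x => Filter.Eventually.of_forall fun t => ?_
      by_cases ht : t ∈ A
      · simp only [indicator_of_mem ht, norm_mul, Real.norm_eq_abs K]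
        exact mul_le_mul_of_nonneg_left (hC _) (abs_nonneg _)
      · simp [indicator_of_notMem ht]
    · rw [integrable_indicator_iff hAm]
      exact integrableOn_const hAfin
    · refine Filter.Eventually.of_forall fun t => ?_
      refine tendsto_const_nhds.congr' ?_
      have h1 := (tendsto_norm_cocompact_atTop).comp
        (Homeomorph.subRight t).isClosedEmbedding.tendsto_cocompact
      filter_upwards [h1.eventually_gt_atTop R] with x hx
      have h2 : k (x - t) = 0 := by
        by_contra hne
        exact (hR _ (subset_tsupport k hne)).not_gt hx
      simp [indicator, h2]
  rw [integral_zero] at hlim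
  filter_upwards [hlim.eventually_lt_const (half_pos hκ)] with x hx
  rw [kernelConvolution_apply]
  have h1 : ∫ t, k (x - t) * h t ≤
      ∫ t, (k (x - t) * (κ / 2) + K * (A.indicator (fun t => k (x - t)) t)) := by
    refine integral_mono_ae (integrable_mul_of_hasCompactSupport
      (hk.comp (continuous_const.sub continuous_id)) (hasCompactSupport_comp_const_sub hkc x) hh)
      (((hi x).mul_const _).add (((hi x).indicator hAm).const_mul K)) ?_
    filter_upwards [hK] with t ht
    have hkt := hk0 (x - t)
    have hK0 : 0 ≤ K := (abs_nonneg _).trans ht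
    by_cases htA : t ∈ A
    · simp only [indicator_of_mem htA]
      nlinarith [le_abs_self (h t), mul_le_mul_of_nonneg_left ((le_abs_self (h t)).trans ht) hkt,
        mul_nonneg hkt hκ.le]
    · simp only [indicator_of_notMem htA, mul_zero, add_zero]
      refine mul_le_mul_of_nonneg_left ?_ hkt
      by_contra! hlt
      exact htA (subset_toMeasurable _ _ (hlt.trans_le (le_abs_self (h t))))
  have h2 : ∫ t, (k (x - t) * (κ / 2) + K * (A.indicator (fun t => k (x - t)) t)) =
      κ / 2 + ∫ t, K * (A.indicator (fun t => k (x - t)) t) := by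
    rw [integral_add ((hi x).mul_const _) (((hi x).indicator hAm).const_mul K),
      integral_mul_const, integral_sub_left_eq_self k volume x, hk1, one_mul]
  linarith

/-- A sequence of smooth bump functions whose supports shrink to the origin. -/
def shrinkingBump (n i : ℕ) : ContDiffBump (0 : EuclideanSpace ℝ (Fin n)) where
  rIn := 1 / (i + 1)
  rOut := 2 * (1 / (i + 1))
  rIn_pos := by positivity
  rIn_lt_rOut := by
    have : (0 : ℝ) < 1 / (i + 1) := by positivity
    linarith

/-- The `i`-th mollification of a function. -/
def mollify {n : ℕ} (i : ℕ) (h : EuclideanSpace ℝ (Fin n) → ℝ) : EuclideanSpace ℝ (Fin n) → ℝ :=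
  kernelConvolution ((shrinkingBump n i).normed volume) h

theorem ae_tendsto_mollify (hh : LocallyIntegrable h volume) :
    ∀ᵐ x, Filter.Tendsto (fun i => mollify i h x) Filter.atTop (nhds (h x)) := by
  simp only [mollify, kernelConvolution_eq_convolution]
  -- The constant `2` is the ratio of outer to inner radius in `shrinkingBump`.
  refine ContDiffBump.ae_convolution_tendsto_right_of_locallyIntegrable (K := 2) ?_
    (Filter.Eventually.of_forall fun i => le_rfl) hh
  have h1 := (tendsto_one_div_add_atTop_nhds_zero_nat (𝕜 := ℝ)).const_mul 2
  rwa [mul_zero] at h1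

/-! ### Sign and constancy of weak solutions. -/

section WeakSubsolution

variable {ρ : EuclideanSpace ℝ (Fin n) → ℝ} {c : ℝ}

theorem mul_mollify_le_laplacian (hh : LocallyIntegrable h volume) (hρ : ∀ᵐ x, ρ x ≤ 0)
    (hweak : ∀ η : EuclideanSpace ℝ (Fin n) → ℝ, ContDiff ℝ ∞ η → HasCompactSupport η →
      ∫ x, (-Laplacian.laplacian η x + c * η x) * h x = ∫ x, η x * ρ x)
    (i : ℕ) (x : EuclideanSpace ℝ (Fin n)) :
    c * mollify i h x ≤ Laplacian.laplacian (mollify i h) x :=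
  mul_kernelConvolution_le_laplacian (ContDiffBump.contDiff_normed _)
    (ContDiffBump.hasCompactSupport_normed _) (ContDiffBump.nonneg_normed _) hh hρ hweak x

theorem contDiff_mollify (hh : LocallyIntegrable h volume) (i : ℕ) :
    ContDiff ℝ 2 (mollify i h) :=
  contDiff_two_of_contDiff_top (contDiff_kernelConvolution (ContDiffBump.contDiff_normed _)
    (ContDiffBump.hasCompactSupport_normed _) hh)

theorem abs_mollify_le {K : ℝ} (hK : ∀ᵐ x, |h x| ≤ K) (i : ℕ) (x : EuclideanSpace ℝ (Fin n)) :
    |mollify i h x| ≤ K :=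
  abs_kernelConvolution_le (ContDiffBump.nonneg_normed _) (ContDiffBump.continuous_normed _)
    (ContDiffBump.hasCompactSupport_normed _) (ContDiffBump.integral_normed _) hK x

theorem ae_nonpos_of_forall_mollify_nonpos (hh : LocallyIntegrable h volume)
    (hm : ∀ i x, mollify i h x ≤ 0) : ∀ᵐ x, h x ≤ 0 := by
  filter_upwards [ae_tendsto_mollify hh] with x hx
  exact le_of_tendsto hx (Filter.Eventually.of_forall fun i => hm i x)

/-- Bounded distributional solutions of `(-Δ + c) h = ρ ≤ 0` with `c > 0` are nonpositive. -/
theorem ae_nonpos_of_weak_of_pos (hh : LocallyIntegrable h volume) {K : ℝ}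
    (hK : ∀ᵐ x, |h x| ≤ K) (hρ : ∀ᵐ x, ρ x ≤ 0) (hc : 0 < c)
    (hweak : ∀ η : EuclideanSpace ℝ (Fin n) → ℝ, ContDiff ℝ ∞ η → HasCompactSupport η →
      ∫ x, (-Laplacian.laplacian η x + c * η x) * h x = ∫ x, η x * ρ x) :
    ∀ᵐ x, h x ≤ 0 :=
  ae_nonpos_of_forall_mollify_nonpos hh fun i x =>
    nonpos_of_mul_le_laplacian (contDiff_mollify hh i) hc (abs_mollify_le hK i)
      (mul_mollify_le_laplacian hh hρ hweak i) x

/-- Bounded distributional solutions of `-Δ h = ρ ≤ 0` that vanish at infinity are nonpositive. -/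
theorem ae_nonpos_of_weak_of_vanishesAtInfinity (hn : 1 ≤ n) (hh : LocallyIntegrable h volume)
    {K : ℝ} (hK : ∀ᵐ x, |h x| ≤ K) (hρ : ∀ᵐ x, ρ x ≤ 0) (hv : VanishesAtInfinity h)
    (hweak : ∀ η : EuclideanSpace ℝ (Fin n) → ℝ, ContDiff ℝ ∞ η → HasCompactSupport η →
      ∫ x, (-Laplacian.laplacian η x + 0 * η x) * h x = ∫ x, η x * ρ x) :
    ∀ᵐ x, h x ≤ 0 :=
  ae_nonpos_of_forall_mollify_nonpos hh fun i x =>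
    nonpos_of_laplacian_nonneg_of_eventually_le hn (contDiff_mollify hh i)
      (fun y => by simpa using mul_mollify_le_laplacian hh hρ hweak i y)
      (fun _ hκ => eventually_kernelConvolution_le (ContDiffBump.nonneg_normed _)
        (ContDiffBump.continuous_normed _) (ContDiffBump.hasCompactSupport_normed _)
        (ContDiffBump.integral_normed _) hh hK hv hκ) x

/-- Bounded distributional solutions of `-Δ h = ρ ≤ 0` in dimension at most two are constant. -/
theorem exists_ae_eq_const_of_weak (hn : n ≤ 2) (hh : LocallyIntegrable h volume)
    {K : ℝ} (hK : ∀ᵐ x, |h x| ≤ K) (hρ : ∀ᵐ x, ρ x ≤ 0)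
    (hweak : ∀ η : EuclideanSpace ℝ (Fin n) → ℝ, ContDiff ℝ ∞ η → HasCompactSupport η →
      ∫ x, (-Laplacian.laplacian η x + 0 * η x) * h x = ∫ x, η x * ρ x) :
    ∃ b, ∀ᵐ x, h x = b := by
  obtain ⟨x₀, hx₀⟩ := (ae_tendsto_mollify hh).exists
  refine ⟨h x₀, ?_⟩
  filter_upwards [ae_tendsto_mollify hh] with x hx
  have h1 : ∀ i, mollify i h x = mollify i h x₀ := fun i =>
    eq_of_bounded_of_laplacian_nonneg hn (contDiff_mollify hh i) (abs_mollify_le hK i)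
      (fun y => by simpa using mul_mollify_le_laplacian hh hρ hweak i y) x x₀
  simp_rw [h1] at hx
  exact tendsto_nhds_unique hx hx₀

end WeakSubsolution

end KernelConvolution

end Mollification

/-! ### Separation of the time variable. -/

noncomputable section Stationary

theorem continuous_exp_phase (ω : ℝ) :
    Continuous fun t : ℝ => Complex.exp (-(Complex.I * ω * t)) := by fun_prop

theorem hasDerivAt_exp_phase (ω t : ℝ) :
    HasDerivAt (fun t : ℝ => Complex.exp (-(Complex.I * ω * t)))
      (-(Complex.I * ω) * Complex.exp (-(Complex.I * ω * t))) t := by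
  have h1 : HasDerivAt (fun t : ℝ => -(Complex.I * ω * t)) (-(Complex.I * ω)) t := by
    simpa using ((Complex.ofRealCLM.hasDerivAt (x := t)).const_mul (Complex.I * ω)).fun_neg
  exact h1.cexp.congr_deriv (mul_comm _ _)

/-- If every test function paired to zero with the phase, the phase would vanish almost everywhere.
The nonzero pairing is the factor cancelled when time is separated. -/
theorem exists_integral_smul_exp_phase_ne_zero (ω : ℝ) :
    ∃ a : ℝ → ℝ, ContDiff ℝ (⊤ : ℕ∞) a ∧ HasCompactSupport a ∧
      ∫ t, a t • Complex.exp (-(Complex.I * ω * t)) ≠ 0 := by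
  by_contra! hcon
  have h := ae_eq_zero_of_integral_contDiff_smul_eq_zero
    ((continuous_exp_phase ω).locallyIntegrable (μ := volume)) hcon
  obtain ⟨t, ht⟩ := h.exists
  exact Complex.exp_ne_zero _ ht

theorem integral_deriv_smul_exp_phase (ω : ℝ) {a : ℝ → ℝ} (ha : ContDiff ℝ (⊤ : ℕ∞) a)
    (hac : HasCompactSupport a) :
    ∫ t, deriv a t • Complex.exp (-(Complex.I * ω * t)) =
      (Complex.I * ω) * ∫ t, a t • Complex.exp (-(Complex.I * ω * t)) := by
  have hi1 : Integrable (fun t => a t • Complex.exp (-(Complex.I * ω * t))) volume :=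
    (ha.continuous.smul (continuous_exp_phase ω)).integrable_of_hasCompactSupport hac.smul_right
  have hi2 : Integrable (fun t => deriv a t • Complex.exp (-(Complex.I * ω * t))) volume :=
    ((ha.continuous_deriv (by simp)).smul (continuous_exp_phase ω)).integrable_of_hasCompactSupport
      hac.deriv.smul_right
  have hd : ∀ t, HasDerivAt (fun t => a t • Complex.exp (-(Complex.I * ω * t)))
      (deriv a t • Complex.exp (-(Complex.I * ω * t))
        - (Complex.I * ω) * (a t • Complex.exp (-(Complex.I * ω * t)))) t := fun t => by
    refine ((ha.differentiable (by simp) t).hasDerivAt.smul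
      (hasDerivAt_exp_phase ω t)).congr_deriv ?_
    simp only [Complex.real_smul]
    ring
  have h := integral_eq_zero_of_hasDerivAt_of_integrable hd (hi2.sub (hi1.const_mul _)) hi1
  rw [integral_sub hi2 (hi1.const_mul _), integral_const_mul, sub_eq_zero] at h
  exact h

theorem integral_real_prod_smul_phase {n N : ℕ} (ω : ℝ) (a : ℝ → ℝ)
    (b : EuclideanSpace ℝ (Fin n) → ℝ) (φ : EuclideanSpace ℝ (Fin n) → Fin N → ℂ) :
    ∫ p : ℝ × EuclideanSpace ℝ (Fin n),
        (a p.1 * b p.2) • (Complex.exp (-(Complex.I * ω * p.1)) • φ p.2) =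
      (∫ t, a t • Complex.exp (-(Complex.I * ω * t))) • ∫ x, b x • φ x := by
  rw [← integral_prod_smul, Measure.volume_eq_prod]
  congr 1 with p k
  simp only [Pi.smul_apply, Complex.real_smul, smul_eq_mul]
  push_cast
  ring

theorem contDiff_tensor {n : ℕ} {a : ℝ → ℝ} {b : EuclideanSpace ℝ (Fin n) → ℝ}
    (ha : ContDiff ℝ (⊤ : ℕ∞) a) (hb : ContDiff ℝ (⊤ : ℕ∞) b) :
    ContDiff ℝ (⊤ : ℕ∞) fun p : ℝ × EuclideanSpace ℝ (Fin n) => a p.1 * b p.2 :=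
  (ha.comp contDiff_fst).mul (hb.comp contDiff_snd)

theorem hasCompactSupport_tensor {n : ℕ} {a : ℝ → ℝ} {b : EuclideanSpace ℝ (Fin n) → ℝ}
    (ha : HasCompactSupport a) (hb : HasCompactSupport b) :
    HasCompactSupport fun p : ℝ × EuclideanSpace ℝ (Fin n) => a p.1 * b p.2 := by
  refine HasCompactSupport.intro (ha.isCompact.prod hb.isCompact) fun p hp => ?_
  rw [mem_prod, not_and_or] at hp
  rcases hp with hp | hp
  · rw [image_eq_zero_of_notMem_tsupport hp, zero_mul]
  · rw [image_eq_zero_of_notMem_tsupport hp, mul_zero]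

variable {n N : ℕ} {α : Fin n → Matrix (Fin N) (Fin N) ℂ} {β : Matrix (Fin N) (Fin N) ℂ}
  {m g M ω : ℝ} {φ : EuclideanSpace ℝ (Fin n) → Fin N → ℂ} {h : EuclideanSpace ℝ (Fin n) → ℝ}

/-- The profile of a solitary wave satisfies the stationary Dirac equation. -/
theorem IsDKGSolitaryWave.stationary_dirac (hw : IsDKGSolitaryWave α β m g M ω φ h)
    {b : EuclideanSpace ℝ (Fin n) → ℝ} (hb : ContDiff ℝ (⊤ : ℕ∞) b) (hbc : HasCompactSupport b) :
    (ω : ℂ) • ∫ x, b x • φ x =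
      Complex.I • ∑ j, (α j).mulVec (∫ x, fderiv ℝ b x (EuclideanSpace.single j 1) • φ x)
        + β.mulVec (∫ x, (b x * (m - g * h x)) • φ x) := by
  obtain ⟨a, ha, hac, hne⟩ := exists_integral_smul_exp_phase_ne_zero ω
  have hd := hw.solution.dirac _ (contDiff_tensor ha hb) (hasCompactSupport_tensor hac hbc)
  have h1 : ∀ p : ℝ × EuclideanSpace ℝ (Fin n),
      deriv (fun s => a s * b p.2) p.1 = deriv a p.1 * b p.2 := fun p => by
    simp
  have h2 : ∀ (p : ℝ × EuclideanSpace ℝ (Fin n)) (v : EuclideanSpace ℝ (Fin n)),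
      fderiv ℝ (fun y => a p.1 * b y) p.2 v = a p.1 * fderiv ℝ b p.2 v := fun p v => by
    rw [fderiv_const_mul (hb.differentiable (by simp) _)]
    simp
  simp only [h1, h2, mul_assoc] at hd
  simp only [← mul_assoc Complex.I] at hd
  rw [integral_real_prod_smul_phase ω (deriv a) b φ] at hd
  simp_rw [fun j => integral_real_prod_smul_phase ω a
    (fun x => fderiv ℝ b x (EuclideanSpace.single j 1)) φ] at hd
  rw [integral_real_prod_smul_phase ω a (fun x => b x * (m - g * h x)) φ,
    integral_deriv_smul_exp_phase ω ha hac] at hd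
  simp only [Matrix.mulVec_smul, ← Finset.smul_sum] at hd
  generalize (∫ t, a t • Complex.exp (-(Complex.I * ω * t))) = A at hd hne
  refine smul_right_injective _ hne ?_
  simp only [smul_add, smul_comm A, smul_smul] at hd ⊢
  rw [← smul_smul] at hd ⊢
  convert hd using 1
  rw [smul_smul, smul_smul]
  congr 1
  linear_combination ((ω : ℂ) * A) * Complex.I_mul_I

theorem diracDensity_phase_smul (ω t : ℝ) (ψ : Fin N → ℂ) :
    diracDensity β (Complex.exp (-(Complex.I * ω * t)) • ψ) = diracDensity β ψ := by
  have h1 : star (Complex.exp (-(Complex.I * ω * t))) * Complex.exp (-(Complex.I * ω * t)) = 1 := by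
    rw [Complex.star_def, ← Complex.exp_conj, ← Complex.exp_add]
    simp
  rw [diracDensity, star_smul, Matrix.mulVec_smul, smul_dotProduct, dotProduct_smul, smul_smul, h1,
    one_smul, diracDensity]

/-- The scalar profile of a solitary wave satisfies the stationary Klein--Gordon equation. -/
theorem IsDKGSolitaryWave.stationary_kleinGordon (hw : IsDKGSolitaryWave α β m g M ω φ h)
    (hh : LocallyIntegrable h volume)
    {b : EuclideanSpace ℝ (Fin n) → ℝ} (hb : ContDiff ℝ (⊤ : ℕ∞) b) (hbc : HasCompactSupport b) :
    ∫ x, (-Laplacian.laplacian b x + M ^ 2 * b x) * h x = ∫ x, b x * diracDensity β (φ x) := by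
  -- The density carries no phase, so frequency `0` is used: it provides `a` with `∫ a ≠ 0`.
  obtain ⟨a, ha, hac, hne⟩ := exists_integral_smul_exp_phase_ne_zero 0
  have hne' : ∫ t, a t ≠ 0 := by
    intro h0
    refine hne ?_
    simp only [Complex.ofReal_zero, mul_zero, zero_mul, neg_zero, Complex.exp_zero]
    rw [integral_smul_const, h0, zero_smul]
  have hd := hw.solution.kleinGordon _ (contDiff_tensor ha hb) (hasCompactSupport_tensor hac hbc)
  have hb2 := contDiff_two_of_contDiff_top hb
  have h1 : ∀ p : ℝ × EuclideanSpace ℝ (Fin n),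
      iteratedDeriv 2 (fun s => a s * b p.2) p.1 = deriv (deriv a) p.1 * b p.2 := fun p => by
    simp [iteratedDeriv_succ]
  have h2 : ∀ p : ℝ × EuclideanSpace ℝ (Fin n),
      Laplacian.laplacian (fun y => a p.1 * b y) p.2 = a p.1 * Laplacian.laplacian b p.2 :=
    fun p => InnerProductSpace.laplacian_smul (a p.1) hb2.contDiffAt
  simp only [h1, h2, diracDensity_phase_smul] at hd
  have ha' : ContDiff ℝ (⊤ : ℕ∞) (deriv a) := ha.iterate_deriv 1
  have ha'' : ContDiff ℝ (⊤ : ℕ∞) (deriv (deriv a)) := ha.iterate_deriv 2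
  have hia'' : Integrable (deriv (deriv a)) volume :=
    ha''.continuous.integrable_of_hasCompactSupport hac.deriv.deriv
  -- This removes the `∂ₜ²` term.
  have h0 : ∫ t, deriv (deriv a) t = 0 :=
    integral_eq_zero_of_hasDerivAt_of_integrable
      (fun t => (ha'.differentiable (by simp) t).hasDerivAt) hia''
      (ha'.continuous.integrable_of_hasCompactSupport hac.deriv)
  have hi1 := hia''.mul_prod (integrable_mul_of_hasCompactSupport hb.continuous hbc hh)
  have hi2 := (ha.continuous.integrable_of_hasCompactSupport (μ := volume) hac).mul_prod
    (((integrable_mul_of_hasCompactSupport (continuous_laplacian hb2)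
      (hasCompactSupport_laplacian hbc) hh).neg).add
      ((integrable_mul_of_hasCompactSupport hb.continuous hbc hh).const_mul (M ^ 2)))
  have hL : ∫ p : ℝ × EuclideanSpace ℝ (Fin n), (deriv (deriv a) p.1 * b p.2
        - a p.1 * Laplacian.laplacian b p.2 + M ^ 2 * (a p.1 * b p.2)) * h p.2 =
      (∫ t, a t) * ∫ x, (-Laplacian.laplacian b x + M ^ 2 * b x) * h x := by
    have h3 := integral_add hi1 hi2
    rw [integral_prod_mul (deriv (deriv a)) fun x => b x * h x, h0, zero_mul, zero_add,
      integral_prod_mul a] at h3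
    refine Eq.trans ?_ (h3.trans ?_)
    · rw [Measure.volume_eq_prod]
      congr 1 with p
      simp only [Pi.add_apply, Pi.neg_apply]
      ring
    · congr 2 with x
      simp only [Pi.add_apply, Pi.neg_apply]
      ring
  have hR : ∫ p : ℝ × EuclideanSpace ℝ (Fin n), a p.1 * b p.2 * diracDensity β (φ p.2) =
      (∫ t, a t) * ∫ x, b x * diracDensity β (φ x) := by
    rw [← integral_prod_mul, Measure.volume_eq_prod]
    simp only [mul_assoc]
  rw [hL, hR] at hd
  exact mul_left_cancel₀ hne' hd

end Stationary

/-! ### Weak first-order equations under the Fourier transform. -/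

noncomputable section FourierSide

open scoped FourierTransform SchwartzMap LineDeriv

variable {n : ℕ}

/-- Complex-valued square integrable functions on `ℝⁿ`. -/
abbrev EuclideanL2 (n : ℕ) : Type := Lp (α := EuclideanSpace ℝ (Fin n)) ℂ 2 volume

/-- A smooth cutoff that equals `1` on the ball of radius `i + 1`. -/
def dilatedCutoff (n i : ℕ) (x : EuclideanSpace ℝ (Fin n)) : ℝ :=
  (⟨1, 2, one_pos, one_lt_two⟩ : ContDiffBump (0 : EuclideanSpace ℝ (Fin n)))
    ((1 / ((i : ℝ) + 1)) • x)

theorem contDiff_dilatedCutoff (n i : ℕ) : ContDiff ℝ (⊤ : ℕ∞) (dilatedCutoff n i) :=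
  (ContDiffBump.contDiff _).comp (contDiff_const_smul (1 / ((i : ℝ) + 1)))

theorem hasCompactSupport_dilatedCutoff (n i : ℕ) : HasCompactSupport (dilatedCutoff n i) :=
  (ContDiffBump.hasCompactSupport _).comp_smul (by positivity)

theorem abs_dilatedCutoff_le_one (n i : ℕ) (x : EuclideanSpace ℝ (Fin n)) :
    |dilatedCutoff n i x| ≤ 1 := by
  rw [dilatedCutoff, abs_of_nonneg (ContDiffBump.nonneg _)]
  exact ContDiffBump.le_one _

theorem tendsto_dilatedCutoff (x : EuclideanSpace ℝ (Fin n)) :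
    Filter.Tendsto (fun i => dilatedCutoff n i x) Filter.atTop (nhds 1) := by
  refine tendsto_const_nhds.congr' ?_
  obtain ⟨k, hk⟩ := exists_nat_ge ‖x‖
  filter_upwards [Filter.eventually_ge_atTop k] with i hi
  refine (ContDiffBump.one_of_mem_closedBall _ ?_).symm
  have h1 : (k : ℝ) ≤ i := by exact_mod_cast hi
  rw [mem_closedBall_zero_iff, norm_smul, Real.norm_of_nonneg (by positivity), one_div,
    inv_mul_le_iff₀ (by positivity)]
  simp only [mul_one]
  linarith

/-- The chain rule supplies the factor `1 / (i + 1)`, so terms with a differentiated cutoff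
disappear in the limit. -/
theorem exists_norm_fderiv_dilatedCutoff_le (n : ℕ) :
    ∃ C, ∀ i x, ‖fderiv ℝ (dilatedCutoff n i) x‖ ≤ 1 / ((i : ℝ) + 1) * C := by
  set χ : ContDiffBump (0 : EuclideanSpace ℝ (Fin n)) := ⟨1, 2, one_pos, one_lt_two⟩ with hχ
  have hs : ContDiff ℝ 1 χ := χ.contDiff
  obtain ⟨C, hC⟩ := (hs.continuous_fderiv (by norm_num)).bounded_above_of_compact_support
    (χ.hasCompactSupport.fderiv ℝ)
  refine ⟨C, fun i x => ?_⟩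
  have h1 : fderiv ℝ (dilatedCutoff n i) x =
      (1 / ((i : ℝ) + 1)) • fderiv ℝ χ ((1 / ((i : ℝ) + 1)) • x) :=
    fderiv_comp_smul (f := χ) (1 / ((i : ℝ) + 1))
  rw [h1, norm_smul, Real.norm_of_nonneg (by positivity)]
  exact mul_le_mul_of_nonneg_left (hC _) (by positivity)

theorem integral_complex_test_eq {f : EuclideanSpace ℝ (Fin n) → ℂ}
    {G : Fin n → EuclideanSpace ℝ (Fin n) → ℂ} (hf : LocallyIntegrable f volume)
    (hG : ∀ j, LocallyIntegrable (G j) volume)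
    (hW : ∀ b : EuclideanSpace ℝ (Fin n) → ℝ, ContDiff ℝ (⊤ : ℕ∞) b → HasCompactSupport b →
      ∫ x, b x • f x = ∑ j, ∫ x, fderiv ℝ b x (EuclideanSpace.single j 1) • G j x)
    {b : EuclideanSpace ℝ (Fin n) → ℂ} (hb : ContDiff ℝ (⊤ : ℕ∞) b) (hbc : HasCompactSupport b) :
    ∫ x, b x * f x = ∑ j, ∫ x, fderiv ℝ b x (EuclideanSpace.single j 1) * G j x := by
  have key : ∀ (L : ℂ →L[ℝ] ℝ), ContDiff ℝ (⊤ : ℕ∞) (fun x => L (b x)) ∧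
      HasCompactSupport (fun x => L (b x)) ∧
      ∀ x v, fderiv ℝ (fun x => L (b x)) x v = L (fderiv ℝ b x v) := fun L => by
    refine ⟨L.contDiff.comp hb, hbc.comp_left (map_zero L), fun x v => ?_⟩
    have h1 := (L.hasFDerivAt.comp x (hb.differentiable (by simp) x).hasFDerivAt).fderiv
    have h2 : fderiv ℝ (fun x => L (b x)) x = _ := h1
    rw [h2]
    rfl
  have hint : ∀ (L : ℂ →L[ℝ] ℝ), Integrable (fun x => L (b x) • f x) volume := fun L =>
    hf.integrable_smul_left_of_hasCompactSupport (key L).1.continuous (key L).2.1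
  have hint' : ∀ (L : ℂ →L[ℝ] ℝ) (j : Fin n), Integrable (fun x =>
      fderiv ℝ (fun x => L (b x)) x (EuclideanSpace.single j 1) • G j x) volume := fun L j =>
    (hG j).integrable_smul_left_of_hasCompactSupport
      (((key L).1.continuous_fderiv (by simp)).clm_apply continuous_const)
      ((key L).2.1.fderiv_apply ℝ _)
  have hre := hW _ (key Complex.reCLM).1 (key Complex.reCLM).2.1
  have him := hW _ (key Complex.imCLM).1 (key Complex.imCLM).2.1
  have hsplit : ∀ z w : ℂ, z * w = z.re • w + Complex.I * (z.im • w) := fun z w => by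
    conv_lhs => rw [← Complex.re_add_im z]
    simp only [Complex.real_smul]
    ring
  have hL : ∫ x, b x * f x = (∫ x, Complex.reCLM (b x) • f x)
      + Complex.I * ∫ x, Complex.imCLM (b x) • f x := by
    rw [← integral_const_mul, ← integral_add (hint _) ((hint _).const_mul _)]
    exact integral_congr_ae (Filter.Eventually.of_forall fun x => hsplit _ _)
  have hR : ∀ j, ∫ x, fderiv ℝ b x (EuclideanSpace.single j 1) * G j x =
      (∫ x, fderiv ℝ (fun x => Complex.reCLM (b x)) x (EuclideanSpace.single j 1) • G j x)
      + Complex.I *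
        ∫ x, fderiv ℝ (fun x => Complex.imCLM (b x)) x (EuclideanSpace.single j 1) • G j x :=
    fun j => by
    rw [← integral_const_mul, ← integral_add (hint' _ j) ((hint' _ j).const_mul _)]
    refine integral_congr_ae (Filter.Eventually.of_forall fun x => ?_)
    simp only [(key _).2.2]
    exact hsplit _ _
  rw [hL, hre, him]
  simp_rw [hR]
  rw [Finset.sum_add_distrib, Finset.mul_sum]

/-- Cut off `θ` and pass to the limit by dominated convergence, a Schwartz function times an `L²`
function being integrable. Schwartz tests are needed because Fourier transforms of test functions
generally lack compact support. -/
theorem integral_schwartz_test_eq {f : EuclideanSpace ℝ (Fin n) → ℂ}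
    {G : Fin n → EuclideanSpace ℝ (Fin n) → ℂ} (hf : MemLp f 2 volume)
    (hG : ∀ j, MemLp (G j) 2 volume)
    (hW : ∀ b : EuclideanSpace ℝ (Fin n) → ℝ, ContDiff ℝ (⊤ : ℕ∞) b → HasCompactSupport b →
      ∫ x, b x • f x = ∑ j, ∫ x, fderiv ℝ b x (EuclideanSpace.single j 1) • G j x)
    (θ : 𝓢(EuclideanSpace ℝ (Fin n), ℂ)) :
    ∫ x, θ x * f x = ∑ j, ∫ x, fderiv ℝ θ x (EuclideanSpace.single j 1) * G j x := by
  have hθ : ContDiff ℝ (⊤ : ℕ∞) θ := θ.smooth ⊤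
  have hχ : ∀ i, ContDiff ℝ (⊤ : ℕ∞) fun x => dilatedCutoff n i x • θ x := fun i =>
    (contDiff_dilatedCutoff n i).smul hθ
  have hW' := fun i => integral_complex_test_eq (hf.locallyIntegrable one_le_two)
    (fun j => (hG j).locallyIntegrable one_le_two) hW (hχ i)
    ((hasCompactSupport_dilatedCutoff n i).smul_right)
  obtain ⟨C, hC⟩ := exists_norm_fderiv_dilatedCutoff_le n
  have hC0 : 0 ≤ C := by
    have := (norm_nonneg _).trans (hC 0 0)
    simpa using this
  have hfd : ∀ i x v, fderiv ℝ (fun x => dilatedCutoff n i x • θ x) x v =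
      dilatedCutoff n i x • fderiv ℝ θ x v + fderiv ℝ (dilatedCutoff n i) x v • θ x :=
    fun i x v => by
    have h1 : HasFDerivAt (fun x => dilatedCutoff n i x • θ x) _ x :=
      ((contDiff_dilatedCutoff n i).differentiable (by simp) x).hasFDerivAt.smul
        (hθ.differentiable (by simp) x).hasFDerivAt
    rw [h1.fderiv]
    simp
  have hlim1 : Filter.Tendsto (fun i => ∫ x, (dilatedCutoff n i x • θ x) * f x) Filter.atTop
      (nhds (∫ x, θ x * f x)) := by
    refine tendsto_integral_of_dominated_convergence (fun x => ‖θ x * f x‖) ?_ ?_ ?_ ?_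
    · exact fun i => ((hχ i).continuous.aestronglyMeasurable).mul hf.aestronglyMeasurable
    · exact ((θ.memLp 2 volume).integrable_mul hf).norm
    · refine fun i => Filter.Eventually.of_forall fun x => ?_
      rw [smul_mul_assoc, norm_smul, Real.norm_eq_abs]
      exact mul_le_of_le_one_left (norm_nonneg _) (abs_dilatedCutoff_le_one n i x)
    · refine Filter.Eventually.of_forall fun x => ?_
      simpa using ((tendsto_dilatedCutoff x).smul_const (θ x)).mul_const (f x)
  have hlim2 : ∀ j, Filter.Tendsto (fun i => ∫ x,
      fderiv ℝ (fun x => dilatedCutoff n i x • θ x) x (EuclideanSpace.single j 1) * G j x)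
      Filter.atTop (nhds (∫ x, fderiv ℝ θ x (EuclideanSpace.single j 1) * G j x)) := by
    intro j
    set v : EuclideanSpace ℝ (Fin n) := EuclideanSpace.single j 1 with hv
    have hv1 : ‖v‖ = 1 := by simp [hv]
    have hle : ∀ i x, ‖fderiv ℝ (dilatedCutoff n i) x v‖ ≤ 1 / ((i : ℝ) + 1) * C := fun i x => by
      refine (ContinuousLinearMap.le_opNorm _ _).trans ?_
      rw [hv1, mul_one]
      exact hC i x
    refine tendsto_integral_of_dominated_convergence
      (fun x => ‖(∂_{v} θ) x * G j x‖ + C * ‖θ x * G j x‖) ?_ ?_ ?_ ?_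
    · exact fun i => ((((hχ i).continuous_fderiv (by simp)).clm_apply
        continuous_const).aestronglyMeasurable).mul (hG j).aestronglyMeasurable
    · exact (((∂_{v} θ).memLp 2 volume).integrable_mul (hG j)).norm.add
        ((((θ.memLp 2 volume).integrable_mul (hG j)).norm).const_mul C)
    · refine fun i => Filter.Eventually.of_forall fun x => ?_
      rw [hfd, SchwartzMap.lineDerivOp_apply_eq_fderiv, add_mul, smul_mul_assoc, smul_mul_assoc]
      refine (norm_add_le _ _).trans (add_le_add ?_ ?_)
      · rw [norm_smul, Real.norm_eq_abs]
        exact mul_le_of_le_one_left (norm_nonneg _) (abs_dilatedCutoff_le_one n i x)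
      · rw [norm_smul]
        refine mul_le_mul_of_nonneg_right ((hle i x).trans ?_) (norm_nonneg _)
        refine mul_le_of_le_one_left hC0 ?_
        rw [div_le_one (by positivity)]
        linarith [(Nat.cast_nonneg i : (0 : ℝ) ≤ i)]
    · refine Filter.Eventually.of_forall fun x => ?_
      simp_rw [hfd]
      have h0 : Filter.Tendsto (fun i => fderiv ℝ (dilatedCutoff n i) x v) Filter.atTop
          (nhds 0) := by
        refine squeeze_zero_norm (fun i => hle i x) ?_
        simpa using (tendsto_one_div_add_atTop_nhds_zero_nat (𝕜 := ℝ)).mul_const C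
      simpa using (((tendsto_dilatedCutoff x).smul_const (fderiv ℝ θ x v)).add
        (h0.smul_const (θ x))).mul_const (G j x)
  have hlim3 := tendsto_finsetSum Finset.univ fun j (_ : j ∈ Finset.univ) => hlim2 j
  simp_rw [← hW'] at hlim3
  exact tendsto_nhds_unique hlim1 hlim3

theorem integral_schwartz_mul_fourier (θ : 𝓢(EuclideanSpace ℝ (Fin n), ℂ))
    (f : EuclideanL2 n) :
    ∫ x, θ x * (𝓕 f : EuclideanL2 n) x = ∫ x, (𝓕 θ) x * f x := by
  have h := congrArg (fun T => T θ) (Lp.fourier_toTemperedDistribution_eq f)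
  simp only [TemperedDistribution.fourier_apply, Lp.toTemperedDistribution_apply,
    smul_eq_mul] at h
  exact h.symm

/-- On the Fourier side, a weak first-order equation becomes an algebraic one. -/
theorem fourier_eq_of_weak (f : EuclideanL2 n)
    (G : Fin n → EuclideanL2 n)
    (hW : ∀ b : EuclideanSpace ℝ (Fin n) → ℝ, ContDiff ℝ (⊤ : ℕ∞) b → HasCompactSupport b →
      ∫ x, b x • f x = ∑ j, ∫ x, fderiv ℝ b x (EuclideanSpace.single j 1) • G j x) :
    ∀ᵐ ξ, (𝓕 f : EuclideanL2 n) ξ =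
      ∑ j, -(2 * Real.pi * Complex.I) * (ξ j) *
        (𝓕 (G j) : EuclideanL2 n) ξ := by
  have hloc : ∀ j, LocallyIntegrable (fun ξ : EuclideanSpace ℝ (Fin n) =>
      -(2 * Real.pi * Complex.I) * (ξ j) *
        (𝓕 (G j) : EuclideanL2 n) ξ) volume := fun j => by
    have h1 := (Lp.memLp (𝓕 (G j) : EuclideanL2 n)).locallyIntegrable
      one_le_two
    rw [locallyIntegrable_iff] at h1 ⊢
    intro K hK
    exact (h1 K hK).continuousOn_mul (Continuous.continuousOn (by fun_prop)) hK
  refine ae_eq_of_integral_contDiff_smul_eq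
    ((Lp.memLp (𝓕 f : EuclideanL2 n)).locallyIntegrable one_le_two)
    (locallyIntegrable_finsetSum _ fun j _ => hloc j) fun b hb hbc => ?_
  have hbC : ContDiff ℝ (⊤ : ℕ∞) fun x => (b x : ℂ) := Complex.ofRealCLM.contDiff.comp hb
  set θ : 𝓢(EuclideanSpace ℝ (Fin n), ℂ) :=
    (hbc.comp_left Complex.ofReal_zero : HasCompactSupport fun x => (b x : ℂ)).toSchwartzMap hbC
    with hθ
  have hθb : ∀ x, θ x = b x := fun x => rfl
  have hL : ∫ x, b x • (𝓕 f : EuclideanL2 n) x = ∫ x, (𝓕 θ) x * f x := by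
    rw [← integral_schwartz_mul_fourier]
    simp_rw [hθb, Complex.real_smul]
  -- The weak equation is tested with `𝓕 θ`, whose partial derivatives are the transforms of `-2πi
  -- ξⱼ θ`.
  rw [hL, integral_schwartz_test_eq (Lp.memLp f) (fun j => Lp.memLp (G j)) hW]
  have hR : ∀ j, ∫ x, fderiv ℝ (𝓕 θ : 𝓢(EuclideanSpace ℝ (Fin n), ℂ)) x (EuclideanSpace.single j 1) * G j x =
      ∫ ξ : EuclideanSpace ℝ (Fin n), b ξ • (-(2 * Real.pi * Complex.I) * (ξ j) *
        (𝓕 (G j) : EuclideanL2 n) ξ) := fun j => by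
    have htg : Function.HasTemperateGrowth fun x : EuclideanSpace ℝ (Fin n) =>
      inner ℝ x (EuclideanSpace.single j (1 : ℝ)) := by fun_prop
    simp_rw [← SchwartzMap.lineDerivOp_apply_eq_fderiv]
    rw [SchwartzMap.lineDerivOp_fourier_eq, ← integral_schwartz_mul_fourier]
    congr 1 with ξ
    rw [smul_apply, SchwartzMap.smulLeftCLM_apply_apply htg, hθb,
      EuclideanSpace.inner_single_right]
    simp only [Complex.real_smul, smul_eq_mul, one_mul]
    simp
    ring
  simp_rw [hR, Finset.smul_sum]
  rw [integral_finsetSum]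
  intro j _
  exact (hloc j).integrable_smul_left_of_hasCompactSupport hb.continuous hbc

end FourierSide

/-! ### Algebra of the Dirac matrices. -/

noncomputable section DiracAlgebra

open scoped Matrix

variable {n N : ℕ} {α : Fin n → Matrix (Fin N) (Fin N) ℂ} {β : Matrix (Fin N) (Fin N) ℂ}

theorem star_mulVec_dotProduct (A : Matrix (Fin N) (Fin N) ℂ) (v w : Fin N → ℂ) :
    star (A *ᵥ v) ⬝ᵥ w = star v ⬝ᵥ (Aᴴ *ᵥ w) := by
  rw [Matrix.star_mulVec, Matrix.dotProduct_mulVec]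

/-- The form of a skew-adjoint matrix equals minus its own conjugate, so it is imaginary. -/
theorem re_dotProduct_mulVec_eq_zero {A : Matrix (Fin N) (Fin N) ℂ} (hA : Aᴴ = -A)
    (v : Fin N → ℂ) : (star v ⬝ᵥ A *ᵥ v).re = 0 := by
  have h1 : star (star v ⬝ᵥ A *ᵥ v) = -(star v ⬝ᵥ A *ᵥ v) := by
    rw [← Matrix.star_dotProduct_star, star_star, star_mulVec_dotProduct, hA, Matrix.neg_mulVec,
      dotProduct_neg]
  have h2 := congrArg Complex.re h1
  rw [Complex.star_def, Complex.conj_re, Complex.neg_re] at h2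
  linarith

theorem star_dotProduct_self_eq (v : Fin N → ℂ) :
    star v ⬝ᵥ v = ((∑ k, ‖v k‖ ^ 2 : ℝ) : ℂ) := by
  simp only [dotProduct, Pi.star_apply, Complex.star_def, Complex.conj_mul']
  push_cast
  rfl

namespace IsDiracMatrices

theorem conjTranspose_beta_mul_alpha (hαβ : IsDiracMatrices α β) (j : Fin n) :
    (β * α j)ᴴ = -(β * α j) := by
  rw [Matrix.conjTranspose_mul, (hαβ.alpha_hermitian j).eq, hαβ.beta_hermitian.eq]
  exact eq_neg_of_add_eq_zero_left (hαβ.alpha_beta_anticomm j)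

/-- Pointwise skew-adjointness of `βD₀` on the Fourier side: each `β * α j` is skew-adjoint and the
coefficients are real. -/
theorem re_star_beta_mulVec_dotProduct (hαβ : IsDiracMatrices α β) (c : Fin n → ℝ)
    (v : Fin N → ℂ) :
    (star (β *ᵥ v) ⬝ᵥ ((∑ j, (c j : ℂ) • α j) *ᵥ v)).re = 0 := by
  rw [star_mulVec_dotProduct, hαβ.beta_hermitian.eq, Matrix.mulVec_mulVec]
  refine re_dotProduct_mulVec_eq_zero ?_ v
  rw [Finset.mul_sum, Matrix.conjTranspose_sum, ← Finset.sum_neg_distrib]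
  refine Finset.sum_congr rfl fun j _ => ?_
  rw [Matrix.mul_smul, Matrix.conjTranspose_smul, hαβ.conjTranspose_beta_mul_alpha, smul_neg,
    Complex.star_def, Complex.conj_ofReal]

theorem beta_mulVec_beta_mulVec (hαβ : IsDiracMatrices α β) (v : Fin N → ℂ) :
    β *ᵥ (β *ᵥ v) = v := by
  rw [Matrix.mulVec_mulVec, ← sq, hαβ.beta_sq, Matrix.one_mulVec]

theorem star_beta_mulVec_dotProduct_self (hαβ : IsDiracMatrices α β) (v : Fin N → ℂ) :
    star (β *ᵥ v) ⬝ᵥ (β *ᵥ v) = star v ⬝ᵥ v := by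
  rw [star_mulVec_dotProduct, hαβ.beta_hermitian.eq, hαβ.beta_mulVec_beta_mulVec]

theorem re_star_beta_mulVec_dotProduct_sub (hαβ : IsDiracMatrices α β) (ω q : ℝ)
    (v : Fin N → ℂ) :
    (star (β *ᵥ v) ⬝ᵥ ((ω : ℂ) • v - (q : ℂ) • (β *ᵥ v))).re =
      ω * diracDensity β v - q * ∑ k, ‖v k‖ ^ 2 := by
  rw [dotProduct_sub, dotProduct_smul, dotProduct_smul, hαβ.star_beta_mulVec_dotProduct_self,
    star_mulVec_dotProduct, hαβ.beta_hermitian.eq, star_dotProduct_self_eq, smul_eq_mul,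
    smul_eq_mul, Complex.sub_re, Complex.re_ofReal_mul, Complex.re_ofReal_mul, Complex.ofReal_re]
  rfl

/-- Expand `0 ≤ ‖v ± βv‖²`, using that `β` is an isometry. -/
theorem abs_diracDensity_le (hαβ : IsDiracMatrices α β) (v : Fin N → ℂ) :
    |diracDensity β v| ≤ ∑ k, ‖v k‖ ^ 2 := by
  have hsub : ∀ s : ℝ, s ^ 2 = 1 → 0 ≤ 2 * ∑ k, ‖v k‖ ^ 2 + 2 * s * diracDensity β v := by
    intro s hs
    have h1 : 0 ≤ (star (v + (s : ℂ) • (β *ᵥ v)) ⬝ᵥ (v + (s : ℂ) • (β *ᵥ v))).re := by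
      rw [star_dotProduct_self_eq, Complex.ofReal_re]
      positivity
    have h2 : star (v + (s : ℂ) • (β *ᵥ v)) ⬝ᵥ (v + (s : ℂ) • (β *ᵥ v)) =
        ((1 + s ^ 2 : ℝ) : ℂ) * (star v ⬝ᵥ v) + ((2 * s : ℝ) : ℂ) * (star v ⬝ᵥ β *ᵥ v) := by
      rw [star_add, star_smul, Complex.star_def, Complex.conj_ofReal, add_dotProduct,
        dotProduct_add, dotProduct_add, smul_dotProduct, smul_dotProduct, dotProduct_smul,
        dotProduct_smul, hαβ.star_beta_mulVec_dotProduct_self, star_mulVec_dotProduct,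
        hαβ.beta_hermitian.eq]
      simp only [smul_eq_mul]
      push_cast
      ring
    rw [h2, hs, star_dotProduct_self_eq, Complex.add_re, Complex.re_ofReal_mul,
      Complex.re_ofReal_mul, Complex.ofReal_re] at h1
    have h3 : (star v ⬝ᵥ β *ᵥ v).re = diracDensity β v := rfl
    rw [h3] at h1
    linarith
  have h1 := hsub 1 (by norm_num)
  have h2 := hsub (-1) (by norm_num)
  rw [abs_le]
  constructor <;> linarith

/-- The symbol of the free Dirac operator squares to a scalar. -/
theorem symbol_mul_symbol (hαβ : IsDiracMatrices α β) (c : Fin n → ℝ) (μ : ℝ) :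
    (∑ j, (c j : ℂ) • α j + (μ : ℂ) • β) * (∑ j, (c j : ℂ) • α j + (μ : ℂ) • β) =
      ((∑ j, c j ^ 2 + μ ^ 2 : ℝ) : ℂ) • (1 : Matrix (Fin N) (Fin N) ℂ) := by
  obtain ⟨S, hS⟩ : ∃ S, S = ∑ j, (c j : ℂ) • α j := ⟨_, rfl⟩
  rw [← hS]
  have h1 : S * S = ((∑ j, c j ^ 2 : ℝ) : ℂ) • (1 : Matrix (Fin N) (Fin N) ℂ) := by
    have h2 : S * S = ∑ j, ∑ k, ((c j : ℂ) * c k) • (α j * α k) := by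
      simp only [hS, Finset.sum_mul, Finset.mul_sum, Matrix.smul_mul, Matrix.mul_smul, smul_smul]
      rw [Finset.sum_comm]
      simp only [mul_comm]
    -- Exchanging the indices lets `S * S + S * S` be summed through anticommutators.
    have h3 : S * S = ∑ j, ∑ k, ((c j : ℂ) * c k) • (α k * α j) := by
      rw [h2, Finset.sum_comm]
      refine Finset.sum_congr rfl fun j _ => Finset.sum_congr rfl fun k _ => ?_
      rw [mul_comm (c k : ℂ)]
    have h4 : S * S + S * S = (2 : ℂ) • (((∑ j, c j ^ 2 : ℝ) : ℂ) • 1) := by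
      refine (congrArg₂ (· + ·) h2 h3).trans ?_
      simp_rw [← Finset.sum_add_distrib, ← smul_add, hαβ.alpha_anticomm, smul_ite, smul_zero,
        Finset.sum_ite_eq, Finset.mem_univ, if_true]
      rw [← Finset.sum_smul, smul_comm, two_smul, one_add_one_eq_two]
      congr 1
      push_cast
      simp only [sq]
    have h5 : (2 : ℂ) • (S * S) = (2 : ℂ) • (((∑ j, c j ^ 2 : ℝ) : ℂ) • 1) := by
      rw [← h4, two_smul]
    exact smul_right_injective _ two_ne_zero h5
  have h2 : S * β + β * S = 0 := by
    simp only [hS, Finset.sum_mul, Finset.mul_sum, Matrix.smul_mul, Matrix.mul_smul]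
    rw [← Finset.sum_add_distrib]
    refine Finset.sum_eq_zero fun j _ => ?_
    rw [← smul_add, hαβ.alpha_beta_anticomm, smul_zero]
  have h3 : β * β = 1 := by rw [← sq, hαβ.beta_sq]
  calc (S + (μ : ℂ) • β) * (S + (μ : ℂ) • β)
      = S * S + (μ : ℂ) • (S * β + β * S) + ((μ : ℂ) * μ) • (β * β) := by
        simp only [add_mul, mul_add, Matrix.smul_mul, Matrix.mul_smul, smul_add, smul_smul]
        abel
    _ = _ := by
        rw [h1, h2, h3, smul_zero, add_zero, ← add_smul]
        congr 1
        push_cast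
        ring

end IsDiracMatrices

end DiracAlgebra

/-! ### Plancherel for spinors and the free Dirac operator. -/

noncomputable section SpinorFourier

open scoped Matrix FourierTransform

variable {n N : ℕ} {α : Fin n → Matrix (Fin N) (Fin N) ℂ} {β : Matrix (Fin N) (Fin N) ℂ}

theorem coeFn_sum_smul (c : Fin N → ℂ) (Φ : Fin N → EuclideanL2 n) :
    ∀ᵐ x, (∑ l, c l • Φ l : EuclideanL2 n) x = ∑ l, c l * Φ l x := by
  have h1 : ∀ᵐ x, ∀ l, (c l • Φ l : EuclideanL2 n) x = c l * Φ l x :=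
    ae_all_iff.2 fun l => Lp.coeFn_smul (c l) (Φ l)
  filter_upwards [Lp.coeFn_finsetSum Finset.univ fun l => c l • Φ l, h1] with x hx hx1
  rw [hx, Finset.sum_apply]
  exact Finset.sum_congr rfl fun l _ => hx1 l

theorem fourier_sum_smul (c : Fin N → ℂ) (Φ : Fin N → EuclideanL2 n) :
    (𝓕 (∑ l, c l • Φ l) : EuclideanL2 n) = ∑ l, c l • (𝓕 (Φ l) : EuclideanL2 n) := by
  change Lp.fourierTransformₗᵢ (EuclideanSpace ℝ (Fin n)) ℂ _ = _
  rw [map_sum]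
  simp only [map_smul]
  rfl

/-- The values of a family of square integrable functions, as a vector. -/
def spinorValue (Φ : Fin N → EuclideanL2 n) (x : EuclideanSpace ℝ (Fin n)) : Fin N → ℂ :=
  fun l => Φ l x

theorem spinorValue_fourier_mulVec (B : Matrix (Fin N) (Fin N) ℂ) (Φ F : Fin N → EuclideanL2 n)
    (hF : ∀ᵐ x, spinorValue F x = B *ᵥ spinorValue Φ x) :
    ∀ᵐ ξ, spinorValue (fun k => (𝓕 (F k) : EuclideanL2 n)) ξ =
      B *ᵥ spinorValue (fun k => (𝓕 (Φ k) : EuclideanL2 n)) ξ := by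
  have h1 : ∀ k, F k = ∑ l, B k l • Φ l := fun k => by
    refine Lp.ext ?_
    filter_upwards [hF, coeFn_sum_smul (B k) Φ] with x hx hx1
    rw [hx1]
    exact congrFun hx k
  have h2 := ae_all_iff.2 fun k => coeFn_sum_smul (B k) fun l => (𝓕 (Φ l) : EuclideanL2 n)
  filter_upwards [h2] with ξ hξ
  funext k
  simp only [spinorValue]
  rw [h1, fourier_sum_smul, hξ k]
  rfl

/-- `-i ∑ αʲ ∂ⱼ` becomes multiplication by `2π ∑ ξⱼ αʲ` under the Fourier transform. -/
theorem spinorValue_fourier_eq_of_weak (Φ F : Fin N → EuclideanL2 n)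
    (hW : ∀ b : EuclideanSpace ℝ (Fin n) → ℝ, ContDiff ℝ (⊤ : ℕ∞) b → HasCompactSupport b →
      ∀ k, ∫ x, b x • F k x = Complex.I * ∑ j, ∑ l, α j k l *
        ∫ x, fderiv ℝ b x (EuclideanSpace.single j 1) • Φ l x) :
    ∀ᵐ ξ, spinorValue (fun k => (𝓕 (F k) : EuclideanL2 n)) ξ =
      (∑ j, ((2 * Real.pi * ξ j : ℝ) : ℂ) • α j) *ᵥ
        spinorValue (fun k => (𝓕 (Φ k) : EuclideanL2 n)) ξ := by
  have h1 : ∀ k, ∀ᵐ ξ, (𝓕 (F k) : EuclideanL2 n) ξ =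
      ∑ j, -(2 * Real.pi * Complex.I) * (ξ j) *
        (𝓕 (∑ l, (Complex.I * α j k l) • Φ l) : EuclideanL2 n) ξ := fun k => by
    refine fourier_eq_of_weak (F k) (fun j => ∑ l, (Complex.I * α j k l) • Φ l) fun b hb hbc => ?_
    rw [hW b hb hbc k, Finset.mul_sum]
    refine Finset.sum_congr rfl fun j _ => ?_
    have hint : ∀ l, Integrable
        (fun x => fderiv ℝ b x (EuclideanSpace.single j 1) • Φ l x) volume := fun l =>
      ((Lp.memLp (Φ l)).locallyIntegrable one_le_two).integrable_smul_left_of_hasCompactSupport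
        ((hb.continuous_fderiv (by simp)).clm_apply continuous_const) (hbc.fderiv_apply ℝ _)
    have h2 : ∫ x, fderiv ℝ b x (EuclideanSpace.single j 1) •
        (∑ l, (Complex.I * α j k l) • Φ l : EuclideanL2 n) x =
        ∫ x, ∑ l, (Complex.I * α j k l) *
          (fderiv ℝ b x (EuclideanSpace.single j 1) • Φ l x) := by
      refine integral_congr_ae ?_
      filter_upwards [coeFn_sum_smul (fun l => Complex.I * α j k l) Φ] with x hx
      rw [hx, Finset.smul_sum]
      refine Finset.sum_congr rfl fun l _ => ?_
      rw [mul_smul_comm]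
    rw [h2, integral_finsetSum _ fun l _ => (hint l).const_mul _, Finset.mul_sum]
    refine Finset.sum_congr rfl fun l _ => ?_
    rw [integral_const_mul, mul_assoc]
  have h2 := ae_all_iff.2 h1
  have h3 := ae_all_iff.2 fun k => ae_all_iff.2 fun j =>
    coeFn_sum_smul (fun l => Complex.I * α j k l) fun l => (𝓕 (Φ l) : EuclideanL2 n)
  filter_upwards [h2, h3] with ξ hξ hξ3
  funext k
  simp only [spinorValue]
  rw [hξ k]
  simp_rw [fourier_sum_smul, hξ3]
  rw [Matrix.sum_mulVec, Finset.sum_apply]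
  simp only [Matrix.smul_mulVec, Pi.smul_apply, smul_eq_mul]
  simp only [Matrix.mulVec, dotProduct, Finset.mul_sum, spinorValue]
  refine Finset.sum_congr rfl fun j _ => Finset.sum_congr rfl fun l _ => ?_
  push_cast
  linear_combination (-(2 * Real.pi * ξ j) * α j k l * (𝓕 (Φ l) : EuclideanL2 n) ξ : ℂ) *
    Complex.I_mul_I

/-- Reduces the spinor pairing to scalar `L²` inner products, to which Parseval's identity applies.
-/
theorem integral_star_mulVec_dotProduct (B : Matrix (Fin N) (Fin N) ℂ)
    (Φ F : Fin N → EuclideanL2 n) :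
    Integrable (fun x => star (B *ᵥ spinorValue Φ x) ⬝ᵥ spinorValue F x) volume ∧
    ∫ x, star (B *ᵥ spinorValue Φ x) ⬝ᵥ spinorValue F x =
      ∑ k, ∑ l, star (B k l) * inner ℂ (Φ l) (F k) := by
  have h1 : ∀ x, star (B *ᵥ spinorValue Φ x) ⬝ᵥ spinorValue F x =
      ∑ k, ∑ l, star (B k l) * inner ℂ (Φ l x) (F k x) := fun x => by
    simp only [dotProduct, Pi.star_apply, Matrix.mulVec, spinorValue, star_sum, star_mul',
      Finset.sum_mul, RCLike.inner_apply, Complex.star_def]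
    refine Finset.sum_congr rfl fun k _ => Finset.sum_congr rfl fun l _ => ?_
    ring
  have hint : ∀ k l, Integrable (fun x => star (B k l) * inner ℂ (Φ l x) (F k x)) volume :=
    fun k l => (L2.integrable_inner (𝕜 := ℂ) (Φ l) (F k)).const_mul _
  simp_rw [h1]
  refine ⟨integrable_finsetSum _ fun k _ => integrable_finsetSum _ fun l _ => hint k l, ?_⟩
  rw [integral_finsetSum _ fun k _ => integrable_finsetSum _ fun l _ => hint k l]
  refine Finset.sum_congr rfl fun k _ => ?_
  rw [integral_finsetSum _ fun l _ => hint k l]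
  refine Finset.sum_congr rfl fun l _ => ?_
  rw [integral_const_mul, L2.inner_def]

theorem integral_star_mulVec_dotProduct_fourier (B : Matrix (Fin N) (Fin N) ℂ)
    (Φ F : Fin N → EuclideanL2 n) :
    ∫ x, star (B *ᵥ spinorValue (fun k => (𝓕 (Φ k) : EuclideanL2 n)) x) ⬝ᵥ
        spinorValue (fun k => (𝓕 (F k) : EuclideanL2 n)) x =
      ∫ x, star (B *ᵥ spinorValue Φ x) ⬝ᵥ spinorValue F x := by
  rw [(integral_star_mulVec_dotProduct B _ _).2, (integral_star_mulVec_dotProduct B _ _).2]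
  simp only [Lp.inner_fourier_eq]

/-- The identity `Re ⟨βΦ, D₀Φ⟩ = 0`, which holds since `βD₀` is skew-adjoint. -/
theorem integral_re_star_beta_mulVec_eq_zero (hαβ : IsDiracMatrices α β)
    (Φ F : Fin N → EuclideanL2 n)
    (hF : ∀ᵐ ξ, spinorValue (fun k => (𝓕 (F k) : EuclideanL2 n)) ξ =
      (∑ j, ((2 * Real.pi * ξ j : ℝ) : ℂ) • α j) *ᵥ
        spinorValue (fun k => (𝓕 (Φ k) : EuclideanL2 n)) ξ) :
    ∫ x, (star (β *ᵥ spinorValue Φ x) ⬝ᵥ spinorValue F x).re = 0 := by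
  have h1 := integral_re (𝕜 := ℂ) (integral_star_mulVec_dotProduct β Φ F).1
  have h2 := integral_re (𝕜 := ℂ) (integral_star_mulVec_dotProduct β
    (fun k => (𝓕 (Φ k) : EuclideanL2 n)) fun k => (𝓕 (F k) : EuclideanL2 n)).1
  simp only [RCLike.re_to_complex] at h1 h2
  -- On the Fourier side the integrand vanishes pointwise.
  rw [h1, ← integral_star_mulVec_dotProduct_fourier, ← h2]
  refine integral_eq_zero_of_ae ?_
  filter_upwards [hF] with ξ hξ
  rw [hξ]
  exact hαβ.re_star_beta_mulVec_dotProduct _ _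

/-- The free Dirac operator has no square integrable eigenfunctions. -/
theorem eq_zero_of_symbol_mulVec_eq (hn : 1 ≤ n) (hαβ : IsDiracMatrices α β) (ω μ : ℝ)
    (Φ : Fin N → EuclideanL2 n)
    (hF : ∀ᵐ ξ, ((ω : ℂ) • (1 : Matrix (Fin N) (Fin N) ℂ) - (μ : ℂ) • β) *ᵥ
        spinorValue (fun k => (𝓕 (Φ k) : EuclideanL2 n)) ξ =
      (∑ j, ((2 * Real.pi * ξ j : ℝ) : ℂ) • α j) *ᵥ
        spinorValue (fun k => (𝓕 (Φ k) : EuclideanL2 n)) ξ) :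
    ∀ k, Φ k = 0 := by
  have hnt : Nontrivial (EuclideanSpace ℝ (Fin n)) := by
    have : Nonempty (Fin n) := ⟨⟨0, hn⟩⟩
    infer_instance
  -- A nonzero value at `ξ` forces `|2πξ|² = ω² - μ²`. If the right side is negative, `Real.sqrt`
  -- returns `0` and the excluded sphere is a point, still null as `n ≥ 1`.
  have hsphere : ∀ᵐ ξ : EuclideanSpace ℝ (Fin n),
      ξ ∉ Metric.sphere (0 : EuclideanSpace ℝ (Fin n))
        (Real.sqrt (ω ^ 2 - μ ^ 2) / (2 * Real.pi)) :=
    measure_eq_zero_iff_ae_notMem.1 (Measure.addHaar_sphere _ _ _)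
  have hzero : ∀ᵐ ξ, spinorValue (fun k => (𝓕 (Φ k) : EuclideanL2 n)) ξ = 0 := by
    filter_upwards [hF, hsphere] with ξ hξ hs
    generalize spinorValue (fun k => (𝓕 (Φ k) : EuclideanL2 n)) ξ = v at hξ ⊢
    have h1 : (∑ j, ((2 * Real.pi * ξ j : ℝ) : ℂ) • α j + (μ : ℂ) • β) *ᵥ v = (ω : ℂ) • v := by
      rw [Matrix.add_mulVec, ← hξ, Matrix.sub_mulVec, Matrix.smul_mulVec, Matrix.one_mulVec]
      abel
    have h2 : ((∑ j, (2 * Real.pi * ξ j) ^ 2 + μ ^ 2 : ℝ) : ℂ) • v = ((ω ^ 2 : ℝ) : ℂ) • v := by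
      have h3 := congrArg (fun A => A *ᵥ v)
        (hαβ.symbol_mul_symbol (fun j => 2 * Real.pi * ξ j) μ)
      simp only at h3
      rw [← Matrix.mulVec_mulVec, h1, Matrix.mulVec_smul, h1, smul_smul, Matrix.smul_mulVec,
        Matrix.one_mulVec] at h3
      rw [← h3]
      congr 1
      push_cast
      ring
    rw [← sub_eq_zero, ← sub_smul, smul_eq_zero] at h2
    refine h2.resolve_left fun h3 => hs ?_
    have h4 : ∑ j, (2 * Real.pi * ξ j) ^ 2 + μ ^ 2 = ω ^ 2 := by
      have := sub_eq_zero.1 h3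
      exact_mod_cast this
    have h5 : ∑ j, (2 * Real.pi * ξ j) ^ 2 = (2 * Real.pi * ‖ξ‖) ^ 2 := by
      simp_rw [mul_pow _ (ξ _)]
      rw [mul_pow _ ‖ξ‖, EuclideanSpace.norm_sq_eq, Finset.mul_sum]
      simp
    rw [mem_sphere_zero_iff_norm, eq_div_iff (by positivity), ← h4, h5, add_sub_cancel_right,
      Real.sqrt_sq (by positivity), mul_comm]
  intro k
  have h1 : (𝓕 (Φ k) : EuclideanL2 n) = 0 := by
    refine Lp.ext ?_
    filter_upwards [hzero, Lp.coeFn_zero ℂ 2 (volume : Measure (EuclideanSpace ℝ (Fin n)))]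
      with ξ hξ h0
    rw [h0]
    exact congrFun hξ k
  have h2 : ‖Φ k‖ = 0 := by rw [← Lp.norm_fourier_eq, h1, norm_zero]
  exact norm_eq_zero.1 h2

end SpinorFourier

/-! ### Excluding nonpositive and constant scalar fields. -/

noncomputable section SolitaryWave

open scoped Matrix FourierTransform

variable {n N : ℕ} {α : Fin n → Matrix (Fin N) (Fin N) ℂ} {β : Matrix (Fin N) (Fin N) ℂ}
  {m g M ω : ℝ} {φ : EuclideanSpace ℝ (Fin n) → Fin N → ℂ} {h : EuclideanSpace ℝ (Fin n) → ℝ}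

/-- The square integrable representatives of the profile `φ` and of `D₀φ`. -/
theorem IsDKGSolitaryWave.exists_spinorValue (hw : IsDKGSolitaryWave α β m g M ω φ h)
    (hφ : MemLp φ 2 volume) (hh : MemLp h ⊤ volume) :
    ∃ Φ F : Fin N → EuclideanL2 n, (∀ᵐ x, spinorValue Φ x = φ x) ∧
      (∀ᵐ x, spinorValue F x =
        (ω : ℂ) • spinorValue Φ x - ((m - g * h x : ℝ) : ℂ) • (β *ᵥ spinorValue Φ x)) ∧
      ∀ᵐ ξ, spinorValue (fun k => (𝓕 (F k) : EuclideanL2 n)) ξ =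
        (∑ j, ((2 * Real.pi * ξ j : ℝ) : ℂ) • α j) *ᵥ
          spinorValue (fun k => (𝓕 (Φ k) : EuclideanL2 n)) ξ := by
  have hφl : ∀ l, MemLp (fun x => φ x l) 2 volume := hφ.eval
  -- Boundedness of `h` keeps the potential term, hence `D₀φ`, in `L²`.
  have hq : MemLp (fun x => ((m - g * h x : ℝ) : ℂ)) ⊤ volume :=
    ((memLp_top_const m).sub (hh.const_mul g)).ofReal
  have hqφ : ∀ l, MemLp (fun x => ((m - g * h x : ℝ) : ℂ) * φ x l) 2 volume := fun l =>
    (hφl l).mul' hq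
  have hβφ : ∀ k, MemLp (fun x => ∑ l, β k l * (((m - g * h x : ℝ) : ℂ) * φ x l)) 2 volume :=
    fun k => memLp_finsetSum _ fun l _ => (hqφ l).const_mul (β k l)
  have hf : ∀ k, MemLp (fun x => (ω : ℂ) * φ x k
      - ∑ l, β k l * (((m - g * h x : ℝ) : ℂ) * φ x l)) 2 volume := fun k =>
    ((hφl k).const_mul (ω : ℂ)).sub (hβφ k)
  have hΦ : ∀ᵐ x, spinorValue (fun l => (hφl l).toLp) x = φ x := by
    filter_upwards [ae_all_iff.2 fun l => (hφl l).coeFn_toLp] with x hx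
    exact funext hx
  have hF := ae_all_iff.2 fun k => (hf k).coeFn_toLp
  refine ⟨fun l => (hφl l).toLp, fun k => (hf k).toLp, hΦ, ?_, ?_⟩
  · filter_upwards [hΦ, hF] with x hx hxF
    rw [hx]
    funext k
    simp only [spinorValue, hxF, Pi.sub_apply, Pi.smul_apply, smul_eq_mul, Matrix.mulVec,
      dotProduct, Finset.mul_sum]
    congr 1
    exact Finset.sum_congr rfl fun l _ => by ring
  · refine spinorValue_fourier_eq_of_weak _ _ fun b hb hbc k => ?_
    have hint : ∀ {u : EuclideanSpace ℝ (Fin n) → ℂ}, MemLp u 2 volume →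
        Integrable (fun x => b x • u x) volume := fun hu =>
      (hu.locallyIntegrable one_le_two).integrable_smul_left_of_hasCompactSupport hb.continuous hbc
    have hint' : ∀ (j : Fin n) {u : EuclideanSpace ℝ (Fin n) → ℂ}, MemLp u 2 volume →
        Integrable (fun x => fderiv ℝ b x (EuclideanSpace.single j 1) • u x) volume :=
      fun j _ hu => (hu.locallyIntegrable one_le_two).integrable_smul_left_of_hasCompactSupport
        ((hb.continuous_fderiv (by simp)).clm_apply continuous_const) (hbc.fderiv_apply ℝ _)
    have hqb : ∀ x l, ((b x * (m - g * h x)) • φ x) l =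
        b x • (((m - g * h x : ℝ) : ℂ) * φ x l) := fun x l => by
      simp only [Pi.smul_apply, Complex.real_smul]
      push_cast
      ring
    have hs := congrFun (hw.stationary_dirac hb hbc) k
    simp only [Pi.add_apply, Pi.smul_apply, Finset.sum_apply, smul_eq_mul, Matrix.mulVec,
      dotProduct] at hs
    rw [eval_integral (f := fun x => b x • φ x) (fun l => hint (hφl l))] at hs
    simp_rw [fun j => eval_integral
      (f := fun x => fderiv ℝ b x (EuclideanSpace.single j 1) • φ x)
      (fun l => hint' j (hφl l))] at hs
    simp_rw [eval_integral (f := fun x => (b x * (m - g * h x)) • φ x)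
      (fun l => by simp_rw [hqb]; exact hint (hqφ l))] at hs
    simp_rw [hqb] at hs
    have hL : ∫ x, b x • (hf k).toLp _ x = (ω : ℂ) * (∫ x, b x • φ x k) -
        ∑ l, β k l * ∫ x, b x • (((m - g * h x : ℝ) : ℂ) * φ x l) := by
      simp_rw [← integral_const_mul]
      rw [← integral_finsetSum _ fun l _ => (hint (hqφ l)).const_mul _,
        ← integral_sub ((hint (hφl k)).const_mul _)
          (integrable_finsetSum _ fun l _ => (hint (hqφ l)).const_mul _)]
      refine integral_congr_ae ?_
      filter_upwards [hF] with x hx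
      rw [hx k, smul_sub, Finset.smul_sum]
      simp only [mul_smul_comm]
    have hR : ∀ j l, ∫ x, fderiv ℝ b x (EuclideanSpace.single j 1) • (hφl l).toLp _ x =
        ∫ x, fderiv ℝ b x (EuclideanSpace.single j 1) • φ x l := fun j l => by
      refine integral_congr_ae ?_
      filter_upwards [(hφl l).coeFn_toLp] with x hx
      rw [hx]
    rw [hL]
    simp_rw [hR]
    simp only [Pi.smul_apply] at hs
    rw [hs]
    ring

/-- The real part of the pairing of `βφ` with `D₀φ` integrates to zero, yet is pointwise at most
`-(m - |ω|)|φ|²` since `-g h ≥ 0`. -/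
theorem IsDKGSolitaryWave.false_of_ae_nonpos (hαβ : IsDiracMatrices α β)
    (hw : IsDKGSolitaryWave α β m g M ω φ h) (hφ : MemLp φ 2 volume) (hh : MemLp h ⊤ volume)
    (hg : 0 < g) (hω : |ω| < m) (h0 : ∀ᵐ x, h x ≤ 0) : False := by
  obtain ⟨Φ, F, hΦ, hF, hFourier⟩ := hw.exists_spinorValue hφ hh
  have hE := integral_re_star_beta_mulVec_eq_zero hαβ Φ F hFourier
  have hi : Integrable (fun x => (star (β *ᵥ spinorValue Φ x) ⬝ᵥ spinorValue F x).re) volume :=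
    (integral_star_mulVec_dotProduct β Φ F).1.re
  have hpt : ∀ᵐ x, (m - |ω|) * ∑ k, ‖φ x k‖ ^ 2 ≤
      -(star (β *ᵥ spinorValue Φ x) ⬝ᵥ spinorValue F x).re := by
    filter_upwards [hΦ, hF, h0] with x hx hxF hx0
    rw [hxF, hx, hαβ.re_star_beta_mulVec_dotProduct_sub]
    have h1 := hαβ.abs_diracDensity_le (φ x)
    have h2 : ω * diracDensity β (φ x) ≤ |ω| * ∑ k, ‖φ x k‖ ^ 2 :=
      (le_abs_self _).trans ((abs_mul _ _).trans_le (mul_le_mul_of_nonneg_left h1 (abs_nonneg _)))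
    have h3 : 0 ≤ ∑ k, ‖φ x k‖ ^ 2 := by positivity
    have h4 : 0 ≤ -(g * h x) := by nlinarith
    nlinarith [mul_nonneg h4 h3]
  have hnn : 0 ≤ᵐ[volume] fun x => -(star (β *ᵥ spinorValue Φ x) ⬝ᵥ spinorValue F x).re := by
    filter_upwards [hpt] with x hx
    refine le_trans ?_ hx
    have : 0 ≤ m - |ω| := by linarith
    simp only [Pi.zero_apply]
    positivity
  have hz : (fun x => -(star (β *ᵥ spinorValue Φ x) ⬝ᵥ spinorValue F x).re) =ᵐ[volume] 0 := by
    refine (integral_eq_zero_iff_of_nonneg_ae hnn hi.neg).1 ?_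
    rw [integral_neg, hE, neg_zero]
  refine hw.nontrivial ?_
  filter_upwards [hpt, hz] with x hx hxz
  rw [hxz, Pi.zero_apply] at hx
  have h1 : ∑ k, ‖φ x k‖ ^ 2 ≤ 0 := by
    by_contra! hpos
    have : 0 < m - |ω| := by linarith
    nlinarith [mul_pos this hpos]
  have h2 := (Finset.sum_eq_zero_iff_of_nonneg fun k _ => sq_nonneg ‖φ x k‖).1
    (le_antisymm h1 (by positivity))
  funext k
  simpa using h2 k (Finset.mem_univ k)

/-- A constant field only shifts the mass to `m - g * c`; neither the sign of this mass nor its size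
relative to `ω` matters. -/
theorem IsDKGSolitaryWave.false_of_ae_eq_const (hn : 1 ≤ n) (hαβ : IsDiracMatrices α β)
    (hw : IsDKGSolitaryWave α β m g M ω φ h) (hφ : MemLp φ 2 volume) (hh : MemLp h ⊤ volume)
    {c : ℝ} (hc : ∀ᵐ x, h x = c) : False := by
  obtain ⟨Φ, F, hΦ, hF, hFourier⟩ := hw.exists_spinorValue hφ hh
  have hF' : ∀ᵐ x, spinorValue F x =
      ((ω : ℂ) • (1 : Matrix (Fin N) (Fin N) ℂ) - ((m - g * c : ℝ) : ℂ) • β) *ᵥ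
        spinorValue Φ x := by
    filter_upwards [hF, hc] with x hx hxc
    rw [hx, hxc, Matrix.sub_mulVec, Matrix.smul_mulVec, Matrix.smul_mulVec, Matrix.one_mulVec]
  have hzero := eq_zero_of_symbol_mulVec_eq hn hαβ ω (m - g * c) Φ (by
    filter_upwards [spinorValue_fourier_mulVec _ Φ F hF', hFourier] with ξ h1 h2
    rw [← h1, h2])
  refine hw.nontrivial ?_
  filter_upwards [hΦ, Lp.coeFn_zero ℂ 2 (volume : Measure (EuclideanSpace ℝ (Fin n)))]
    with x hx hx0
  rw [← hx]
  funext k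
  simp only [spinorValue, hzero k, hx0, Pi.zero_apply]

theorem ae_abs_le_of_memLp_top (hh : MemLp h ⊤ volume) : ∃ K, ∀ᵐ x, |h x| ≤ K := by
  refine ⟨(eLpNorm h ⊤ volume).toReal, ?_⟩
  filter_upwards [ae_le_eLpNormEssSup (f := h) (μ := volume)] with x hx
  rw [← eLpNorm_exponent_top] at hx
  rw [← Real.norm_eq_abs, ← toReal_enorm]
  exact ENNReal.toReal_mono hh.2.ne hx

end SolitaryWave

theorem mainTheorem1 (n N : ℕ) (hn : 1 ≤ n)
    (α : Fin n → Matrix (Fin N) (Fin N) ℂ) (β : Matrix (Fin N) (Fin N) ℂ)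
    (hαβ : IsDiracMatrices α β)
    (m g M ω : ℝ) (hg : 0 < g) (hM : 0 ≤ M) (hω : ω ∈ Ioo (-m) m) :
    ¬ ∃ (φ : EuclideanSpace ℝ (Fin n) → Fin N → ℂ) (h : EuclideanSpace ℝ (Fin n) → ℝ),
      IsDKGSolitaryWave α β m g M ω φ h ∧
      MemLp φ 2 volume ∧ MemLp h ⊤ volume ∧
      (M = 0 → 3 ≤ n → VanishesAtInfinity h) ∧
      ∀ᵐ x, diracDensity β (φ x) ≤ 0 := by
  rintro ⟨φ, h, hw, hφ, hh, hv, hρ⟩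
  have hloc : LocallyIntegrable h volume := hh.locallyIntegrable le_top
  obtain ⟨K, hK⟩ := ae_abs_le_of_memLp_top hh
  have hω' : |ω| < m := abs_lt.2 hω
  have hweak := fun (η : EuclideanSpace ℝ (Fin n) → ℝ) (h1 : ContDiff ℝ (⊤ : ℕ∞) η)
    (h2 : HasCompactSupport η) => hw.stationary_kleinGordon hloc h1 h2
  rcases hM.eq_or_lt with hM0 | hMpos
  · have hweak0 : ∀ η : EuclideanSpace ℝ (Fin n) → ℝ, ContDiff ℝ (⊤ : ℕ∞) η →
        HasCompactSupport η →
        ∫ x, (-Laplacian.laplacian η x + 0 * η x) * h x =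
          ∫ x, η x * diracDensity β (φ x) := fun η h1 h2 => by
      simpa [← hM0] using hweak η h1 h2
    rcases le_or_gt n 2 with hn2 | hn3
    -- Without decay the constant may be positive, so the sign argument is unavailable here.
    · obtain ⟨c, hc⟩ := exists_ae_eq_const_of_weak hn2 hloc hK hρ hweak0
      exact hw.false_of_ae_eq_const hn hαβ hφ hh hc
    · exact hw.false_of_ae_nonpos hαβ hφ hh hg hω'
        (ae_nonpos_of_weak_of_vanishesAtInfinity hn hloc hK hρ (hv hM0.symm hn3) hweak0)
  · exact hw.false_of_ae_nonpos hαβ hφ hh hg hω'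
      (ae_nonpos_of_weak_of_pos hloc hK hρ (by positivity : 0 < M ^ 2) hweak)
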